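/- Definitions. An instance of 2-covariate matching consists of $n$ treatment samples and $n'$ control samples, a first covariate that assigns to each sample one of $k_1$ levels and a second covariate that assigns to each sample one of $k_2$ levels, and a matrix of distances $\delta_{ij}\in\mathbb{Z}_{\ge 0}$ between treatment samples $i$ and control samples $j$. For $p=1,2$ and $q=1,\dots,k_p$ let $\ell_{p,q}$ be the number of treatment samples in level $q$ of covariate $p$, and let $L'_{p,q}$ be the set of control samples in level $q$ of covariate $p$. For an integer $\kappa\ge 1$, a feasible solution assigns to every treatment sample $i$ a set $A_i$ of exactly $\kappa$ control samples such that the sets $A_i$ are pairwise disjoint and their union $S'$ satisfies the $\kappa$-fine-balance constraints $|S'\cap L'_{p,q}|=\kappa\,\ell_{p,q}$ for $p=1,2$ and $q=1,\dots,k_p$. The cost of a solution is $\sum_{i}\sum_{j\in A_i}\delta_{ij}$. The problem $\kappa$-BM' is to find a feasible solution of minimum cost, or to report that there is no feasible solution, where $\kappa$ and the number $k_2$ of levels of the second covariate are constants, $n,n',k_1$ are part of the input, and all distances are given in unary. BM' denotes the case $\kappa=1$. A polynomial time algorithm is a deterministic Turing machine that, on every instance, outputs a correct answer in time polynomial in the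 input length. Theorem. Let $\kappa\ge 2$ be a constant. For every constant $k_2$, there is a polynomial time algorithm for BM' with $k_2$ levels of the second covariate if and only if there is a polynomial time algorithm for $\kappa$-BM' with $k_2$ levels of the second covariate. -/

import Mathlib

namespace FineBalance

/-- An instance of two-covariate (`κ`-)fine-balance matching whose second covariate has `k₂` levels:
`n` treatment samples, `n'` control samples, a first covariate with an arbitrary number `k₁` of
levels, and a matrix of nonnegative integral distances between treatment and control samples.
Levels may be empty. -/
structure Instance (k₂ : ℕ) where
  /-- number of treatment samples -/
  n : ℕ
  /-- number of control samples -/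
  n' : ℕ
  /-- number of levels of the first covariate -/
  k₁ : ℕ
  /-- level of each treatment sample under the first covariate -/
  tLevel₁ : Fin n → Fin k₁
  /-- level of each treatment sample under the second covariate -/
  tLevel₂ : Fin n → Fin k₂
  /-- level of each control sample under the first covariate -/
  cLevel₁ : Fin n' → Fin k₁
  /-- level of each control sample under the second covariate -/
  cLevel₂ : Fin n' → Fin k₂
  /-- distance between a treatment and a control sample -/
  dist : Fin n → Fin n' → ℕ

/-- The `κ`-fine-balance constraints of one covariate, given by its level maps `lev` and `lev'` on
the treatment and control groups, for the selections `S` and `S'`: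
`κ * |S ∩ L_q| = |S' ∩ L'_q|` for every level `q`. -/
def FineBalanced {T C L : Type} [DecidableEq L] (κ : ℕ) (lev : T → L) (lev' : C → L)
    (S : Finset T) (S' : Finset C) : Prop :=
  ∀ q : L, κ * (S.filter fun t => lev t = q).card = (S'.filter fun c => lev' c = q).card

namespace Instance

variable {k₂ : ℕ}

/-- An assignment gives to each treatment sample a set of control samples matched to it. -/
abbrev Assignment (I : Instance k₂) : Type := Fin I.n → Finset (Fin I.n')

/-- The selection of all control samples that are matched. -/
def matched (I : Instance k₂) (A : I.Assignment) : Finset (Fin I.n') :=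
  Finset.univ.biUnion A

/-- Feasible solutions of `κ`-BM: every treatment sample is matched to exactly `κ` control samples,
no control sample is matched to two treatment samples, and the whole treatment group together with
the selection of matched control samples satisfies the `κ`-fine-balance constraints under both
covariates. -/
structure Feasible (κ : ℕ) (I : Instance k₂) (A : I.Assignment) : Prop where
  card_eq : ∀ i, (A i).card = κ
  disjoint : ∀ i i', i ≠ i' → Disjoint (A i) (A i')
  balanced₁ : FineBalanced κ I.tLevel₁ I.cLevel₁ Finset.univ (I.matched A)
  balanced₂ : FineBalanced κ I.tLevel₂ I.cLevel₂ Finset.univ (I.matched A)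

/-- Total distance of all matched pairs. -/
def cost (I : Instance k₂) (A : I.Assignment) : ℕ :=
  ∑ i, ∑ j ∈ A i, I.dist i j

/-- Optimal solutions of `κ`-BM. -/
def Optimal (κ : ℕ) (I : Instance k₂) (A : I.Assignment) : Prop :=
  I.Feasible κ A ∧ ∀ B : I.Assignment, I.Feasible κ B → I.cost A ≤ I.cost B

end Instance

/-- Input alphabet. -/
inductive InSymbol : Type
  /-- unary digit -/
  | tick
  /-- end of a unary numeral -/
  | comma
  /-- end of the list of treatment samples, and end of the record of a control sample -/
  | semi
  deriving DecidableEq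

instance : Fintype InSymbol where
  elems := {InSymbol.tick, InSymbol.comma, InSymbol.semi}
  complete := by intro x; cases x <;> simp

/-- Output alphabet. -/
inductive OutSymbol : Type
  /-- the pair is not matched -/
  | zero
  /-- the pair is matched -/
  | one
  /-- end of the record of a control sample -/
  | semi
  /-- report that there is no feasible solution -/
  | infeasible
  deriving DecidableEq

instance : Fintype OutSymbol where
  elems := {OutSymbol.zero, OutSymbol.one, OutSymbol.semi, OutSymbol.infeasible}
  complete := by intro x; cases x <;> simp

/-- Unary numerals with an end marker. -/
def unary (m : ℕ) : List InSymbol :=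
  List.replicate m InSymbol.tick ++ [InSymbol.comma]

/-- Input words, with all numbers in unary: the number `k₁`, then the two levels of every treatment
sample, then one record for every control sample, consisting of its two levels and its distances to
all treatment samples. -/
def Instance.encode {k₂ : ℕ} (I : Instance k₂) : List InSymbol :=
  unary I.k₁
    ++ ((List.finRange I.n).flatMap fun i => unary (I.tLevel₁ i) ++ unary (I.tLevel₂ i))
    ++ [InSymbol.semi]
    ++ (List.finRange I.n').flatMap fun j =>
        unary (I.cLevel₁ j) ++ unary (I.cLevel₂ j)
          ++ ((List.finRange I.n).flatMap fun i => unary (I.dist i j))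
          ++ [InSymbol.semi]

/-- Output word of an assignment: its 0-1 incidence matrix, one record for every control sample. -/
def Instance.encodeAssignment {k₂ : ℕ} (I : Instance k₂) (A : I.Assignment) : List OutSymbol :=
  (List.finRange I.n').flatMap fun j =>
    ((List.finRange I.n).map fun i => if j ∈ A i then OutSymbol.one else OutSymbol.zero)
      ++ [OutSymbol.semi]

/-- Correct answers to an instance of `κ`-BM: an optimal solution, or the report that there is no
feasible solution if this is the case. -/
def Instance.IsAnswer {k₂ : ℕ} (κ : ℕ) (I : Instance k₂) (w : List OutSymbol) : Prop :=
  (∃ A : I.Assignment, I.Optimal κ A ∧ w = I.encodeAssignment A) ∨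
    ((¬ ∃ A : I.Assignment, I.Feasible κ A) ∧ w = [OutSymbol.infeasible])

/-- There is a (deterministic) polynomial time algorithm for `κ`-BM' with `k₂` levels of the second
covariate: a Turing machine that, in time polynomial in the length of the input word, writes a
correct answer for every instance. The numbers `κ` and `k₂` are constants of the problem. -/
def HasPolyTimeAlgorithm (κ k₂ : ℕ) : Prop :=
  ∃ f : Instance k₂ → List OutSymbol,
    (∀ I : Instance k₂, I.IsAnswer κ (f I)) ∧
      Nonempty (Turing.TM2ComputableInPolyTime Instance.encode (fun w : List OutSymbol => w) f)

/-- There is a polynomial time algorithm for BM' with `k₂` levels of the second covariate; BM is the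
case `κ = 1` of `κ`-BM. -/
def BMHasPolyTimeAlgorithm (k₂ : ℕ) : Prop :=
  HasPolyTimeAlgorithm 1 k₂

end FineBalance

/-! Each direction is a reduction of instances together with a translation of answers back; both
reductions keep the sets of levels.

From `κ`-BM to BM, every treatment sample is replaced by `κ` copies (`Instance.copies`). The
treatment side of every level grows by the factor `κ`, which is the factor in the `κ`-constraints,
and a set of `κ` partners can be distributed over the copies arbitrarily because copies have equal
distances. So merging copies maps the feasible solutions onto those of `κ`-BM and preserves cost
(`Feasible.merge`, `exists_merge_eq`, `cost_merge`).

From BM to `(m + 1)`-BM, every treatment sample receives `m` dummy controls with its own levels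
(`Instance.padded`). A dummy has distance 0 to its owner and `N` to the other treatment samples, and
real distances are raised by `N`, where `N` is the length of the input word. Because distances are
in unary, `N` exceeds the cost of every BM assignment (`cost_lt_length`) and can itself be written
in unary. A BM solution of cost `c` extends to one of cost `n * N + c`, whereas a solution in which
some dummy is not with its owner has at least `n + 1` pairs of cost at least `N`. Hence, if BM is
feasible, an optimal padded solution consists of all dummy-owner pairs and an optimal BM solution
(`Optimal.castAdd_mem`, `Optimal.unpad`). The padded instance may be feasible although BM is not;
this is recognised by an unmatched dummy, because once all dummies are matched, no matter to whom,
the other `n` selected controls are balanced and any bijection to them is feasible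
(`exists_feasible_of_leftPart`).

For the machines, reductions and translations are written as structured stack programs that compile
without loss of time (`compile_reaches`). Polynomial time computations between words indexed by
instances compose (`PolyComputes.comp`), and `HasPolyTimeAlgorithm.of_reduction` chains reduction,
given algorithm and translation. -/

namespace StackProgram

/-! ### Structured stack programs and their compilation to stack machines. -/

/-- Structured programs on finitely many stacks, indexed by `K`, over the alphabet `α`. -/
inductive Prog (K α : Type) : Type
  /-- do nothing -/
  | skip : Prog K α
  /-- push a symbol -/
  | push (k : K) (a : α) : Prog K α
  /-- sequential composition -/
  | seq (p q : Prog K α) : Prog K α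
  /-- pop a symbol `x` (`none` if the stack is empty), run `body x`, and repeat if `again x` -/
  | loop (k : K) (body : Option α → Prog K α) (again : Option α → Bool) : Prog K α

variable {K α : Type}

section Semantics

variable [DecidableEq K]

/-- `Runs p S S' t`: from the stacks `S` the program `p` reaches the stacks `S'` in time `t`. -/
inductive Runs : Prog K α → (K → List α) → (K → List α) → ℕ → Prop
  | skip (S) : Runs Prog.skip S S 0
  | push (k a S) : Runs (Prog.push k a) S (Function.update S k (a :: S k)) 1
  | seq {p q S S' S'' t t'} : Runs p S S' t → Runs q S' S'' t' → Runs (Prog.seq p q) S S'' (t + t')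
  | last {k body again S S' t} : again (S k).head? = false →
      Runs (body (S k).head?) (Function.update S k (S k).tail) S' t →
      Runs (Prog.loop k body again) S S' (t + 1)
  | more {k body again S S' S'' t t'} : again (S k).head? = true →
      Runs (body (S k).head?) (Function.update S k (S k).tail) S' t →
      Runs (Prog.loop k body again) S' S'' t' →
      Runs (Prog.loop k body again) S S'' (t + 1 + t')
  | mono {p S S' t t'} : Runs p S S' t → t ≤ t' → Runs p S S' t'

end Semantics

/-- Machine instructions over the labels `Λ`; the label `none` is the exit. -/
inductive Instr (K α Λ : Type) : Type
  | push (k : K) (a : α) (next : Option Λ) : Instr K α Λ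
  | pop (k : K) (next : Option α → Option Λ) : Instr K α Λ

/-- Relabelling of an instruction. -/
def Instr.map {Λ Λ' : Type} (f : Option Λ → Option Λ') : Instr K α Λ → Instr K α Λ'
  | push k a next => push k a (f next)
  | pop k next => pop k fun x => f (next x)

/-- Effect of an instruction. -/
def Instr.exec [DecidableEq K] {Λ : Type} :
    Instr K α Λ → (K → List α) → Option Λ × (K → List α)
  | push k a next, S => (next, Function.update S k (a :: S k))
  | pop k next, S => (next (S k).head?, Function.update S k (S k).tail)

theorem Instr.exec_map [DecidableEq K] {Λ Λ' : Type} (f : Option Λ → Option Λ')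
    (c : Instr K α Λ) (S : K → List α) :
    (c.map f).exec S = (f (c.exec S).1, (c.exec S).2) := by
  cases c <;> rfl

/-- Unstructured code with finitely many labels. -/
structure Code (K α : Type) : Type 1 where
  /-- labels -/
  Λ : Type
  /-- there are finitely many labels -/
  fin : Fintype Λ
  /-- entry point -/
  entry : Option Λ
  /-- instructions -/
  instr : Λ → Instr K α Λ

/-- The code `C` leads from one configuration to another one in a number of steps. -/
inductive Code.Reaches [DecidableEq K] (C : Code K α) :
    Option C.Λ × (K → List α) → Option C.Λ × (K → List α) → ℕ → Prop
  | refl (c) : Reaches C c c 0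
  | step {l S c t} : Reaches C ((C.instr l).exec S) c t → Reaches C (some l, S) c (t + 1)

namespace Code

variable [DecidableEq K]

theorem Reaches.trans {C : Code K α} {a b c t t'} (h : C.Reaches a b t) (h' : C.Reaches b c t') :
    C.Reaches a c (t + t') := by
  induction h with
  | refl => simpa using h'
  | step _ ih => rw [Nat.add_right_comm]; exact (ih h').step

/-- Embedded code behaves like the original one. -/
theorem Reaches.embed {C C' : Code K α} (g : C.Λ → C'.Λ) (x : Option C'.Λ)
    (h : ∀ l, C'.instr (g l) = (C.instr l).map fun o => o.elim x fun l => some (g l))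
    {a b t} (hr : C.Reaches a b t) :
    C'.Reaches (a.1.elim x fun l => some (g l), a.2) (b.1.elim x fun l => some (g l), b.2) t := by
  induction hr with
  | refl => exact .refl _
  | step _ ih =>
    refine Reaches.step ?_
    rw [h, Instr.exec_map]
    exact ih

end Code

/-- Compilation of structured programs. -/
def compile [Fintype α] : Prog K α → Code K α
  | .skip => ⟨Empty, inferInstance, none, Empty.elim⟩
  | .push k a => ⟨Unit, inferInstance, some (), fun _ => .push k a none⟩
  | .seq p q =>
    { Λ := (compile p).Λ ⊕ (compile q).Λ
      fin := @instFintypeSum _ _ (compile p).fin (compile q).fin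
      entry := (compile p).entry.elim
        ((compile q).entry.elim none fun l => some (.inr l)) fun l => some (.inl l)
      instr := Sum.elim
        (fun l => ((compile p).instr l).map fun o => o.elim
          ((compile q).entry.elim none fun l => some (.inr l)) fun l => some (.inl l))
        (fun l => ((compile q).instr l).map fun o => o.elim none fun l => some (.inr l)) }
  | .loop k body again =>
    { Λ := Option (Σ x : Option α, (compile (body x)).Λ)
      fin := haveI := fun x => (compile (body x)).fin; inferInstance
      entry := some none
      instr := fun l => l.elim
        (.pop k fun x => (compile (body x)).entry.elim (cond (again x) (some none) none)
          fun l => some (some ⟨x, l⟩))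
        fun l => ((compile (body l.1)).instr l.2).map fun o => o.elim
          (cond (again l.1) (some none) none) fun l' => some (some ⟨l.1, l'⟩) }

/-- Compilation costs no time: the exit of a subprogram is replaced by the entry of its
continuation, so passing control takes no step. An inequality remains only because `Runs` is closed
under raising the time bound. -/
theorem compile_reaches [DecidableEq K] [Fintype α] {p : Prog K α} {S S' : K → List α} {t : ℕ}
    (h : Runs p S S' t) :
    ∃ t' ≤ t, (compile p).Reaches ((compile p).entry, S) (none, S') t' := by
  induction h with
  | skip S => exact ⟨0, le_rfl, .refl _⟩
  | push k a S => exact ⟨1, le_rfl, .step (.refl _)⟩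
  | @seq p q S S' S'' t t' _ _ ih ih' =>
    obtain ⟨n, hn, h⟩ := ih
    obtain ⟨n', hn', h'⟩ := ih'
    refine ⟨n + n', by omega, Code.Reaches.trans
      (h.embed (C' := compile (p.seq q)) Sum.inl
        ((compile q).entry.elim none fun l => some (.inr l)) fun l => rfl) ?_⟩
    exact h'.embed (C' := compile (p.seq q)) Sum.inr none fun l => rfl
  | @last k body again S S' t ha _ ih =>
    obtain ⟨n, hn, h⟩ := ih
    have := h.embed (C' := compile (.loop k body again)) (fun l => some ⟨(S k).head?, l⟩)
      (cond (again (S k).head?) (some none) none) fun l => rfl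
    refine ⟨n + 1, by omega, Code.Reaches.step ?_⟩
    rw [ha] at this
    convert! this using 1
    simp [compile, Instr.exec, ha]
  | @more k body again S S' S'' t t' ha _ _ ih ih' =>
    obtain ⟨n, hn, h⟩ := ih
    obtain ⟨n', hn', h'⟩ := ih'
    have := h.embed (C' := compile (.loop k body again)) (fun l => some ⟨(S k).head?, l⟩)
      (cond (again (S k).head?) (some none) none) fun l => rfl
    refine ⟨n + 1 + n', by omega, Code.Reaches.trans (Code.Reaches.step ?_) h'⟩
    rw [ha] at this
    convert! this using 1
    simp [compile, Instr.exec, ha]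
  | mono _ ht ih =>
    obtain ⟨n, hn, h⟩ := ih
    exact ⟨n, hn.trans ht, h⟩

/-- The statement of a stack machine that executes an instruction. -/
def Instr.toStmt {Λ : Type} : Instr K α Λ → Turing.TM2.Stmt (fun _ : K => α) (Option Λ) (Option α)
  | .push k a next => .push k (fun _ => a) (.goto fun _ => next)
  | .pop k next => .pop k (fun _ x => x) (.goto next)

theorem Instr.stepAux_toStmt [DecidableEq K] {Λ : Type} (c : Instr K α Λ) (v : Option α)
    (S : K → List α) :
    ∃ w, Turing.TM2.stepAux c.toStmt v S = ⟨some (c.exec S).1, w, (c.exec S).2⟩ := by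
  cases c <;> exact ⟨_, rfl⟩

/-- The stack machine that executes code, with input on the stack `i` and output on the
stack `o`. -/
def Code.toTM2 [DecidableEq K] [Fintype K] [Fintype α] (C : Code K α) (i o : K) :
    Turing.FinTM2 where
  K := K
  k₀ := i
  k₁ := o
  Γ _ := α
  Λ := Option C.Λ
  main := C.entry
  ΛFin := @instFintypeOption _ C.fin
  σ := Option α
  initialState := none
  Γk₀Fin := inferInstance
  m l := l.elim (.load (fun _ => none) .halt) fun l => (C.instr l).toStmt

/-- One instruction is one machine step. The initial internal state `v` is arbitrary because only
the jump after a pop reads the state, and that pop has just overwritten it. -/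
theorem Code.Reaches.toTM2 [DecidableEq K] [Fintype K] [Fintype α] {C : Code K α} (i o : K)
    {a b t} (h : C.Reaches a b t) (v : Option α) :
    ∃ v', (flip bind (C.toTM2 i o).step)^[t] (some ⟨some a.1, v, a.2⟩) =
      some ⟨some b.1, v', b.2⟩ := by
  induction h generalizing v with
  | refl => exact ⟨v, rfl⟩
  | @step l S c t h ih =>
    obtain ⟨w, hw⟩ := (C.instr l).stepAux_toStmt v S
    obtain ⟨v', hv'⟩ := ih w
    refine ⟨v', ?_⟩
    rw [Function.iterate_succ_apply, ← hv']
    exact congrArg (fun c => (flip bind (C.toTM2 i o).step)^[t] (some c)) hw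

end StackProgram

/-! ### Polynomial time computations from one family of words to another. -/

namespace Turing

theorem initList_stk (tm : FinTM2) (s : List (tm.Γ tm.k₀)) :
    (initList tm s).stk = Function.update (fun _ => []) tm.k₀ s := by
  funext k
  by_cases h : k = tm.k₀
  · subst h; simp [initList]
  · simp [initList, h]

theorem haltList_stk (tm : FinTM2) (s : List (tm.Γ tm.k₁)) :
    (haltList tm s).stk = Function.update (fun _ => []) tm.k₁ s := by
  funext k
  by_cases h : k = tm.k₁
  · subst h; simp [haltList]
  · simp [haltList, h]

/-- From the word `ea i` the word `eb i` can be computed in polynomial time. -/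
def PolyComputes {ι Γ₀ Γ₁ : Type} (ea : ι → List Γ₀) (eb : ι → List Γ₁) : Prop :=
  Nonempty (TM2ComputableInPolyTime ea (fun w : List Γ₁ => w) eb)

/-- A structured program yields a polynomial time computation. -/
theorem PolyComputes.of_runs {ι K α : Type} [DecidableEq K] [Fintype K] [Fintype α]
    {ea eb : ι → List α} (p : StackProgram.Prog K α) (k : K) (P : Polynomial ℕ)
    (h : ∀ i, StackProgram.Runs p (Function.update (fun _ => []) k (ea i))
      (Function.update (fun _ => []) k (eb i)) (P.eval (ea i).length)) :
    PolyComputes ea eb := by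
  refine ⟨⟨⟨(StackProgram.compile p).toTM2 k k, Equiv.refl α, Equiv.refl α⟩, P + 1, fun i => ?_⟩⟩
  have H : ∃ n ≤ (P + 1).eval (ea i).length,
      (flip bind ((StackProgram.compile p).toTM2 k k).step)^[n]
        (some (initList ((StackProgram.compile p).toTM2 k k) (ea i))) =
      some (haltList ((StackProgram.compile p).toTM2 k k) (eb i)) := by
    obtain ⟨t, ht, hr⟩ := StackProgram.compile_reaches (h i)
    obtain ⟨v, hv⟩ := hr.toTM2 k k none
    -- The additional step executes the exit label, which halts and resets the internal state to its
    -- initial value, as `haltList` demands.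
    refine ⟨t + 1, by simpa using ht, ?_⟩
    have h1 : initList ((StackProgram.compile p).toTM2 k k) (ea i) =
        ⟨some (StackProgram.compile p).entry, none, Function.update (fun _ => []) k (ea i)⟩ := by
      have := initList_stk ((StackProgram.compile p).toTM2 k k) (ea i)
      rw [show initList ((StackProgram.compile p).toTM2 k k) (ea i) =
        ⟨_, _, (initList ((StackProgram.compile p).toTM2 k k) (ea i)).stk⟩ from rfl, this]
      rfl
    have h2 : haltList ((StackProgram.compile p).toTM2 k k) (eb i) =
        ⟨none, none, Function.update (fun _ => []) k (eb i)⟩ := by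
      have := haltList_stk ((StackProgram.compile p).toTM2 k k) (eb i)
      rw [show haltList ((StackProgram.compile p).toTM2 k k) (eb i) =
        ⟨_, _, (haltList ((StackProgram.compile p).toTM2 k k) (eb i)).stk⟩ from rfl, this]
      rfl
    rw [Function.iterate_succ_apply', h1, h2]
    exact congrArg (flip bind ((StackProgram.compile p).toTM2 k k).step) hv
  choose n hn hn' using H
  refine ⟨⟨n, ?_⟩, hn⟩
  have hid : ∀ l : List α, List.map (Equiv.refl α).invFun l = l := List.map_id
  have ha := hid (ea i)
  have hb := hid (eb i)
  exact (congrArg (fun l => (flip bind ((StackProgram.compile p).toTM2 k k).step)^[n]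
    (some (initList ((StackProgram.compile p).toTM2 k k) l))) ha).trans (hn'.trans
    (congrArg (fun l => some (haltList ((StackProgram.compile p).toTM2 k k) l)) hb).symm)

end Turing

/-! ### Composition of polynomial time machines. -/

namespace Turing

open TM2

section Iterate

variable {C C' : Type} {f : C → Option C}

theorem iterate_bind_none (n : ℕ) : (flip bind f)^[n] none = none := by
  induction n with
  | zero => rfl
  | succ n ih => rw [Function.iterate_succ_apply]; exact ih

theorem iterate_bind_trans {m n : ℕ} {a b c : C} (h : (flip bind f)^[m] (some a) = some b)
    (h' : (flip bind f)^[n] (some b) = some c) : (flip bind f)^[m + n] (some a) = some c := by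
  rw [Nat.add_comm, Function.iterate_add_apply, h, h']

theorem iterate_bind_step {n : ℕ} {a b c : C} (h : f a = some b)
    (h' : (flip bind f)^[n] (some b) = some c) : (flip bind f)^[1 + n] (some a) = some c :=
  iterate_bind_trans (m := 1) h h'

theorem update_nil {K : Type} {Γ : K → Type} [DecidableEq K] (k : K) :
    Function.update (fun _ => []) k [] = (fun _ => [] : ∀ k, List (Γ k)) :=
  Function.update_eq_self k _

/-- Simulation of a machine that has not halted. -/
theorem iterate_bind_map {g : C' → Option C'} (φ : C → C')
    (h : ∀ a b, f a = some b → g (φ a) = some (φ b)) {n : ℕ} {a b : C}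
    (hab : (flip bind f)^[n] (some a) = some b) :
    (flip bind g)^[n] (some (φ a)) = some (φ b) := by
  induction n generalizing a with
  | zero => exact congrArg (Option.map φ) hab
  | succ n ih =>
    rw [Function.iterate_succ_apply] at hab ⊢
    have hab' : (flip bind f)^[n] (f a) = some b := hab
    cases hfa : f a with
    | none => rw [hfa, iterate_bind_none] at hab'; cases hab'
    | some c =>
      rw [hfa] at hab'
      exact (congrArg ((flip bind g)^[n]) (h a c hfa)).trans (ih hab')

end Iterate

section Embedding

variable {K K' Λ Λ' σ σ' : Type} {Γ : K → Type} [DecidableEq K] [DecidableEq K']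

/-- Embedding of a statement of a machine into a larger machine. -/
def embedStmt (e : K' → K) (f : Λ' → Λ) (exit : Option Λ) (get : σ → σ') (put : σ' → σ) :
    Stmt (fun k => Γ (e k)) Λ' σ' → Stmt Γ Λ σ
  | .push k a q => .push (e k) (fun v => a (get v)) (embedStmt e f exit get put q)
  | .peek k a q => .peek (e k) (fun v x => put (a (get v) x)) (embedStmt e f exit get put q)
  | .pop k a q => .pop (e k) (fun v x => put (a (get v) x)) (embedStmt e f exit get put q)
  | .load a q => .load (fun v => put (a (get v))) (embedStmt e f exit get put q)
  | .branch b q q' => .branch (fun v => b (get v)) (embedStmt e f exit get put q)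
      (embedStmt e f exit get put q')
  | .goto l => .goto fun v => f (l (get v))
  | .halt => exit.elim .halt fun l => .goto fun _ => l

/-- Embedding of a configuration of a machine into a larger machine. -/
def embedCfg {e : K' → K} (f : Λ' → Λ) (exit : Option Λ) (put : σ' → σ)
    (J : (∀ k, List (Γ (e k))) → ∀ k, List (Γ k)) (c : Cfg (fun k => Γ (e k)) Λ' σ') :
    Cfg Γ Λ σ :=
  ⟨c.l.elim exit fun l => some (f l), put c.var, J c.stk⟩

/-- An embedded statement touches only stacks in the range of `e`, where `J` reproduces the original
stacks, and sees the state only through `get` and `put`; so execution commutes with the embedding.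
-/
theorem stepAux_embedStmt {e : K' → K} {f : Λ' → Λ} {exit : Option Λ} {get : σ → σ'}
    {put : σ' → σ} (hget : ∀ v, get (put v) = v) {J : (∀ k, List (Γ (e k))) → ∀ k, List (Γ k)}
    (hJ : ∀ S k, J S (e k) = S k)
    (hJu : ∀ S k x, J (Function.update S k x) = Function.update (J S) (e k) x)
    (q : Stmt (fun k => Γ (e k)) Λ' σ') (v : σ') (S : ∀ k, List (Γ (e k))) :
    stepAux (embedStmt e f exit get put q) (put v) (J S) =
      embedCfg f exit put J (stepAux q v S) := by
  induction q generalizing v S with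
  | push k a q ih => simp only [embedStmt, stepAux, hget, hJ, ← hJu, ih]
  | peek k a q ih => simp only [embedStmt, stepAux, hget, hJ, ih]
  | pop k a q ih => simp only [embedStmt, stepAux, hget, hJ, ← hJu, ih]
  | load a q ih => simp only [embedStmt, stepAux, hget, ih]
  | branch b q q' ih ih' =>
    simp only [embedStmt, stepAux, hget, ih, ih']
    cases b v <;> rfl
  | goto l => simp only [embedStmt, stepAux, hget]; rfl
  | halt => cases exit <;> rfl

end Embedding

section Length

/-- The number of push operations in a statement. -/
def pushCount {K Λ σ : Type} {Γ : K → Type} : Stmt Γ Λ σ → ℕ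
  | .push _ _ q => pushCount q + 1
  | .peek _ _ q => pushCount q
  | .pop _ _ q => pushCount q
  | .load _ q => pushCount q
  | .branch _ q q' => pushCount q + pushCount q'
  | .goto _ => 0
  | .halt => 0

theorem length_stepAux_le {K Λ σ : Type} {Γ : K → Type} [DecidableEq K] (q : Stmt Γ Λ σ) (v : σ)
    (S : ∀ k, List (Γ k)) (k : K) :
    ((stepAux q v S).stk k).length ≤ (S k).length + pushCount q := by
  induction q generalizing v S with
  | push k' a q ih =>
    refine (ih _ _).trans ?_
    by_cases h : k = k'
    · subst h; simp only [Function.update_self, List.length_cons, pushCount]; omega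
    · simp only [pushCount, Function.update_of_ne h]; omega
  | peek k' a q ih => exact ih _ _
  | pop k' a q ih =>
    refine (ih _ _).trans ?_
    by_cases h : k = k'
    · subst h; simp [pushCount]
    · simp [pushCount, h]
  | load a q ih => exact ih _ _
  | branch b q q' ih ih' =>
    simp only [stepAux, pushCount]
    cases b v
    · exact (ih' v S).trans (by omega)
    · exact (ih v S).trans (by omega)
  | goto l => simp [pushCount]
  | halt => simp [pushCount]

/-- The largest number of push operations in a step of a machine. -/
def FinTM2.pushBound (M : FinTM2) : ℕ :=
  M.ΛFin.elems.sup fun l => pushCount (M.m l)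

/-- Every step lengthens a stack by at most a constant of the machine. This bounds the output of a
first machine, hence the input of a second one, by a polynomial. -/
theorem FinTM2.length_iterate_le (M : FinTM2) (k : M.K) {n : ℕ} {a b : M.Cfg}
    (h : (flip bind M.step)^[n] (some a) = some b) :
    (b.stk k).length ≤ (a.stk k).length + n * M.pushBound := by
  induction n generalizing a with
  | zero => cases h; simp
  | succ n ih =>
    rw [Function.iterate_succ_apply] at h
    have h' : (flip bind M.step)^[n] (M.step a) = some b := h
    obtain ⟨l, v, S⟩ := a
    cases l with
    | none =>
      rw [show M.step ⟨none, v, S⟩ = none from rfl, iterate_bind_none] at h'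
      cases h'
    | some l =>
      have h1 := ih h'
      have h2 := length_stepAux_le (M.m l) v S k
      have h3 : pushCount (M.m l) ≤ M.pushBound :=
        Finset.le_sup (f := fun l => pushCount (M.m l)) (M.ΛFin.complete l)
      rw [Nat.succ_mul]
      dsimp only at h1 ⊢
      omega

end Length

section Composition

variable (M₁ M₂ : FinTM2) {Γ : Type}

/-- Stack alphabets of the composition of two machines: those of the two machines, and an auxiliary
stack. -/
@[reducible]
def compΓ (Γ : Type) : Option (M₁.K ⊕ M₂.K) → Type
  | none => Γ
  | some (.inl k) => M₁.Γ k
  | some (.inr k) => M₂.Γ k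

variable {M₁ M₂} in
/-- Stacks of the composition of two machines. -/
def compStk (S₁ : ∀ k, List (M₁.Γ k)) (S₂ : ∀ k, List (M₂.Γ k)) (u : List Γ) :
    ∀ k, List (compΓ M₁ M₂ Γ k)
  | none => u
  | some (.inl k) => S₁ k
  | some (.inr k) => S₂ k

theorem compStk_update_left (S₁ : ∀ k, List (M₁.Γ k)) (S₂ : ∀ k, List (M₂.Γ k)) (u : List Γ)
    (k : M₁.K) (x : List (M₁.Γ k)) :
    compStk (Function.update S₁ k x) S₂ u =
      Function.update (compStk S₁ S₂ u) (some (.inl k)) x := by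
  funext j
  rcases j with _ | j | j
  · exact (Function.update_of_ne (a := none)
        (a' := some (Sum.inl k)) (by simp) x (compStk S₁ S₂ u)).symm
  · by_cases h : j = k
    · subst h
      exact (Function.update_self j x S₁).trans
        (Function.update_self (some (Sum.inl j)) x (compStk S₁ S₂ u)).symm
    · exact (Function.update_of_ne h x _).trans
        (Function.update_of_ne (a := some (Sum.inl j))
        (a' := some (Sum.inl k)) (by simpa using h) x (compStk S₁ S₂ u)).symm
  · exact (Function.update_of_ne (a := some (Sum.inr j))
        (a' := some (Sum.inl k)) (by simp) x (compStk S₁ S₂ u)).symm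

theorem compStk_update_right (S₁ : ∀ k, List (M₁.Γ k)) (S₂ : ∀ k, List (M₂.Γ k)) (u : List Γ)
    (k : M₂.K) (x : List (M₂.Γ k)) :
    compStk S₁ (Function.update S₂ k x) u =
      Function.update (compStk S₁ S₂ u) (some (.inr k)) x := by
  funext j
  rcases j with _ | j | j
  · exact (Function.update_of_ne (a := none)
        (a' := some (Sum.inr k)) (by simp) x (compStk S₁ S₂ u)).symm
  · exact (Function.update_of_ne (a := some (Sum.inl j))
        (a' := some (Sum.inr k)) (by simp) x (compStk S₁ S₂ u)).symm
  · by_cases h : j = k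
    · subst h
      exact (Function.update_self j x S₂).trans (Function.update_self (some (Sum.inr j)) x (compStk S₁ S₂ u)).symm
    · exact (Function.update_of_ne h x _).trans
        (Function.update_of_ne (a := some (Sum.inr j))
        (a' := some (Sum.inr k)) (by simpa using h) x (compStk S₁ S₂ u)).symm

theorem compStk_update_aux (S₁ : ∀ k, List (M₁.Γ k)) (S₂ : ∀ k, List (M₂.Γ k)) (u x : List Γ) :
    compStk S₁ S₂ x = Function.update (compStk S₁ S₂ u) none x := by
  funext j
  rcases j with _ | j | j
  · exact (Function.update_self none x (compStk S₁ S₂ u)).symm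
  · exact (Function.update_of_ne (a := some (Sum.inl j))
        (a' := none) (by simp) x (compStk S₁ S₂ u)).symm
  · exact (Function.update_of_ne (a := some (Sum.inr j))
        (a' := none) (by simp) x (compStk S₁ S₂ u)).symm

/-- The composition of two machines. When the first machine halts, its output is moved to the
auxiliary stack (labels `(false, _)`) and from there to the input stack of the second machine
(labels `(true, _)`). -/
def compTM2 [Fintype Γ] (e₁ : M₁.Γ M₁.k₁ ≃ Γ) (e₂ : M₂.Γ M₂.k₀ ≃ Γ) : FinTM2 where
  K := Option (M₁.K ⊕ M₂.K)
  kDecidableEq := inferInstance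
  kFin := haveI := M₁.kFin; haveI := M₂.kFin; inferInstance
  k₀ := some (.inl M₁.k₀)
  k₁ := some (.inr M₂.k₁)
  Γ := compΓ M₁ M₂ Γ
  Λ := M₁.Λ ⊕ M₂.Λ ⊕ Bool × Option Γ
  main := .inl M₁.main
  ΛFin := haveI := M₁.ΛFin; haveI := M₂.ΛFin; inferInstance
  σ := M₁.σ × M₂.σ × Option Γ
  initialState := (M₁.initialState, M₂.initialState, none)
  σFin := haveI := M₁.σFin; haveI := M₂.σFin; inferInstance
  Γk₀Fin := M₁.Γk₀Fin
  m
    | .inl l => embedStmt (Γ := compΓ M₁ M₂ Γ) (fun k => some (.inl k)) Sum.inl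
        (some (.inr (.inr (false, none)))) (fun v => v.1) (fun v => (v, M₂.initialState, none)) (M₁.m l)
    | .inr (.inl l) => embedStmt (Γ := compΓ M₁ M₂ Γ) (fun k => some (.inr k))
        (fun l => .inr (.inl l)) none (fun v => v.2.1) (fun v => (M₁.initialState, v, none))
        (M₂.m l)
    | .inr (.inr (false, none)) => .pop (some (.inl M₁.k₁))
        (fun v x => (v.1, v.2.1, Option.map e₁ x))
        (.goto fun v => v.2.2.elim (.inr (.inr (true, none))) fun a => .inr (.inr (false, some a)))
    | .inr (.inr (false, some a)) => .push none (fun _ => a)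
        (.goto fun _ => .inr (.inr (false, none)))
    | .inr (.inr (true, none)) => .pop none (fun v x => (v.1, v.2.1, x))
        (.goto fun v => v.2.2.elim (.inr (.inl M₂.main)) fun a => .inr (.inr (true, some a)))
    | .inr (.inr (true, some a)) => .push (some (.inr M₂.k₀)) (fun _ => e₂.symm a)
        (.goto fun _ => .inr (.inr (true, none)))

variable [Fintype Γ] (e₁ : M₁.Γ M₁.k₁ ≃ Γ) (e₂ : M₂.Γ M₂.k₀ ≃ Γ)

/-- Configurations of the composition of two machines. -/
def compCfg (l : Option (M₁.Λ ⊕ M₂.Λ ⊕ Bool × Option Γ)) (v : M₁.σ × M₂.σ × Option Γ)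
    (S₁ : ∀ k, List (M₁.Γ k)) (S₂ : ∀ k, List (M₂.Γ k)) (u : List Γ) :
    (compTM2 M₁ M₂ e₁ e₂).Cfg :=
  ⟨l, v, compStk S₁ S₂ u⟩

/-- A halted configuration of `M₁` is identified with the beginning of the transfer phase, so the
simulation includes the halting step. -/
theorem compTM2_left {n : ℕ} {a b : M₁.Cfg} (h : (flip bind M₁.step)^[n] (some a) = some b) :
    (flip bind (compTM2 M₁ M₂ e₁ e₂).step)^[n] (some (compCfg M₁ M₂ e₁ e₂
      (a.l.elim (some (.inr (.inr (false, none)))) fun l => some (.inl l))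
      (a.var, M₂.initialState, none) a.stk (fun _ => []) [])) =
    some (compCfg M₁ M₂ e₁ e₂
      (b.l.elim (some (.inr (.inr (false, none)))) fun l => some (.inl l))
      (b.var, M₂.initialState, none) b.stk (fun _ => []) []) := by
  refine iterate_bind_map (f := M₁.step) (fun a : M₁.Cfg => compCfg M₁ M₂ e₁ e₂
      (a.l.elim (some (.inr (.inr (false, none)))) fun l => some (.inl l))
      (a.var, M₂.initialState, none) a.stk (fun _ => []) []) ?_ h
  rintro ⟨_ | l, v, S⟩ b h
  · cases h
  · cases h
    exact congrArg some (stepAux_embedStmt (Γ := compΓ M₁ M₂ Γ) (e := fun k => some (.inl k))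
      (f := Sum.inl) (exit := some (Sum.inr (Sum.inr (false, none)))) (get := fun v : M₁.σ × M₂.σ × Option Γ => v.1)
      (put := fun v => (v, M₂.initialState, none)) (J := fun S => compStk S (fun _ => []) [])
      (fun _ => rfl) (fun _ _ => rfl) (fun S k x => compStk_update_left M₁ M₂ S _ _ k x)
      (M₁.m l) v S)

theorem compTM2_right {n : ℕ} {a b : M₂.Cfg} (h : (flip bind M₂.step)^[n] (some a) = some b) :
    (flip bind (compTM2 M₁ M₂ e₁ e₂).step)^[n] (some (compCfg M₁ M₂ e₁ e₂
      (a.l.elim none fun l => some (.inr (.inl l)))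
      (M₁.initialState, a.var, none) (fun _ => []) a.stk [])) =
    some (compCfg M₁ M₂ e₁ e₂
      (b.l.elim none fun l => some (.inr (.inl l)))
      (M₁.initialState, b.var, none) (fun _ => []) b.stk []) := by
  refine iterate_bind_map (f := M₂.step) (fun a : M₂.Cfg => compCfg M₁ M₂ e₁ e₂
      (a.l.elim none fun l => some (.inr (.inl l)))
      (M₁.initialState, a.var, none) (fun _ => []) a.stk []) ?_ h
  rintro ⟨_ | l, v, S⟩ b h
  · cases h
  · cases h
    exact congrArg some (stepAux_embedStmt (Γ := compΓ M₁ M₂ Γ) (e := fun k => some (.inr k))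
      (f := fun l => Sum.inr (Sum.inl l)) (exit := none) (get := fun v : M₁.σ × M₂.σ × Option Γ => v.2.1)
      (put := fun v => (M₁.initialState, v, none)) (J := fun S => compStk (fun _ => []) S [])
      (fun _ => rfl) (fun _ _ => rfl) (fun S k x => compStk_update_right M₁ M₂ _ S _ k x)
      (M₂.m l) v S)

theorem compTM2_step_out (v₁ : M₁.σ) (v₂ : M₂.σ) (w : Option Γ) (S₁ : ∀ k, List (M₁.Γ k))
    (S₂ : ∀ k, List (M₂.Γ k)) (u : List Γ) {L : List (M₁.Γ M₁.k₁)} (h : S₁ M₁.k₁ = L) :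
    (compTM2 M₁ M₂ e₁ e₂).step (compCfg M₁ M₂ e₁ e₂
      (some (Sum.inr (Sum.inr (false, none)))) (v₁, v₂, w) S₁ S₂ u) =
    some (compCfg M₁ M₂ e₁ e₂ (some ((Option.map e₁ L.head?).elim (Sum.inr (Sum.inr (true, none)))
      fun a => Sum.inr (Sum.inr (false, some a)))) (v₁, v₂, Option.map e₁ L.head?)
      (Function.update S₁ M₁.k₁ L.tail) S₂ u) := by
  subst h
  rw [compCfg, compCfg, compStk_update_left]
  rfl

theorem compTM2_step_back (v₁ : M₁.σ) (v₂ : M₂.σ) (w : Option Γ) (S₁ : ∀ k, List (M₁.Γ k))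
    (S₂ : ∀ k, List (M₂.Γ k)) (u : List Γ) :
    (compTM2 M₁ M₂ e₁ e₂).step (compCfg M₁ M₂ e₁ e₂
      (some (Sum.inr (Sum.inr (true, none)))) (v₁, v₂, w) S₁ S₂ u) =
    some (compCfg M₁ M₂ e₁ e₂ (some (u.head?.elim (Sum.inr (Sum.inl M₂.main))
      fun a => Sum.inr (Sum.inr (true, some a)))) (v₁, v₂, u.head?) S₁ S₂ u.tail) := by
  rw [compCfg, compCfg, compStk_update_aux M₁ M₂ S₁ S₂ u u.tail]
  rfl

theorem compTM2_step_out_push (v : M₁.σ × M₂.σ × Option Γ) (S₁ : ∀ k, List (M₁.Γ k))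
    (S₂ : ∀ k, List (M₂.Γ k)) (u : List Γ) (a : Γ) :
    (compTM2 M₁ M₂ e₁ e₂).step (compCfg M₁ M₂ e₁ e₂
      (some (Sum.inr (Sum.inr (false, some a)))) v S₁ S₂ u) =
    some (compCfg M₁ M₂ e₁ e₂ (some (Sum.inr (Sum.inr (false, none)))) v S₁ S₂ (a :: u)) := by
  rw [compCfg, compCfg, compStk_update_aux M₁ M₂ S₁ S₂ u (a :: u)]
  rfl

theorem compTM2_step_back_push (v : M₁.σ × M₂.σ × Option Γ) (S₁ : ∀ k, List (M₁.Γ k))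
    (S₂ : ∀ k, List (M₂.Γ k)) (u : List Γ) (a : Γ) :
    (compTM2 M₁ M₂ e₁ e₂).step (compCfg M₁ M₂ e₁ e₂
      (some (Sum.inr (Sum.inr (true, some a)))) v S₁ S₂ u) =
    some (compCfg M₁ M₂ e₁ e₂ (some (Sum.inr (Sum.inr (true, none)))) v S₁
      (Function.update S₂ M₂.k₀ (e₂.symm a :: S₂ M₂.k₀)) u) := by
  rw [compCfg, compCfg, compStk_update_right]
  rfl

/-- Each symbol takes a pop and a push, and one more pop finds the stack empty. The word arrives
reversed; `compTM2_back` reverses it again. -/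
theorem compTM2_out (v₁ : M₁.σ) (v₂ : M₂.σ) (w : Option Γ) (S₂ : ∀ k, List (M₂.Γ k))
    (l : List (M₁.Γ M₁.k₁)) (u : List Γ) :
    (flip bind (compTM2 M₁ M₂ e₁ e₂).step)^[2 * l.length + 1] (some (compCfg M₁ M₂ e₁ e₂
      (some (Sum.inr (Sum.inr (false, none)))) (v₁, v₂, w)
      (Function.update (fun _ => []) M₁.k₁ l) S₂ u)) =
    some (compCfg M₁ M₂ e₁ e₂ (some (Sum.inr (Sum.inr (true, none)))) (v₁, v₂, none)
      (fun _ => []) S₂ ((l.map e₁).reverse ++ u)) := by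
  induction l generalizing u w with
  | nil =>
    have h := compTM2_step_out M₁ M₂ e₁ e₂ v₁ v₂ w
      (Function.update (fun _ => []) M₁.k₁ []) S₂ u (Function.update_self ..)
    rw [Function.update_idem, List.tail_nil, update_nil] at h
    rw [update_nil]
    exact h
  | cons a l ih =>
    have h := compTM2_step_out M₁ M₂ e₁ e₂ v₁ v₂ w
      (Function.update (fun _ => []) M₁.k₁ (a :: l)) S₂ u (Function.update_self ..)
    rw [Function.update_idem] at h
    have h' := iterate_bind_step h (iterate_bind_step
      (compTM2_step_out_push M₁ M₂ e₁ e₂ _ _ _ _ _) (ih (some (e₁ a)) (e₁ a :: u)))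
    rw [show 2 * (a :: l).length + 1 = 1 + (1 + (2 * l.length + 1)) by simp; ring, h']
    simp

theorem compTM2_back (v₁ : M₁.σ) (v₂ : M₂.σ) (w : Option Γ) (S₁ : ∀ k, List (M₁.Γ k))
    (l : List (M₂.Γ M₂.k₀)) (u : List Γ) :
    (flip bind (compTM2 M₁ M₂ e₁ e₂).step)^[2 * u.length + 1] (some (compCfg M₁ M₂ e₁ e₂
      (some (Sum.inr (Sum.inr (true, none)))) (v₁, v₂, w) S₁
      (Function.update (fun _ => []) M₂.k₀ l) u)) =
    some (compCfg M₁ M₂ e₁ e₂ (some (Sum.inr (Sum.inl M₂.main))) (v₁, v₂, none) S₁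
      (Function.update (fun _ => []) M₂.k₀ ((u.map e₂.symm).reverse ++ l)) []) := by
  induction u generalizing l w with
  | nil => exact compTM2_step_back M₁ M₂ e₁ e₂ v₁ v₂ w S₁ _ []
  | cons a u ih =>
    have h := compTM2_step_back_push M₁ M₂ e₁ e₂ (v₁, v₂, some a) S₁
      (Function.update (fun _ => []) M₂.k₀ l) u a
    rw [Function.update_idem, Function.update_self] at h
    have h' := iterate_bind_step
      (compTM2_step_back M₁ M₂ e₁ e₂ v₁ v₂ w S₁ (Function.update (fun _ => []) M₂.k₀ l) (a :: u))
      (iterate_bind_step h (ih (some a) (e₂.symm a :: l)))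
    rw [show 2 * (a :: u).length + 1 = 1 + (1 + (2 * u.length + 1)) by simp; ring, h']
    simp

theorem compTM2_outputs {s : List (M₁.Γ M₁.k₀)} {w : List Γ} {s' : List (M₂.Γ M₂.k₁)} {m n : ℕ}
    (h₁ : (flip bind M₁.step)^[m] (some (initList M₁ s)) =
      some (haltList M₁ (w.map e₁.symm)))
    (h₂ : (flip bind M₂.step)^[n] (some (initList M₂ (w.map e₂.symm))) =
      some (haltList M₂ s')) :
    (flip bind (compTM2 M₁ M₂ e₁ e₂).step)^[m + (4 * w.length + 2 + n)]
      (some (initList (compTM2 M₁ M₂ e₁ e₂) s)) =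
      some (haltList (compTM2 M₁ M₂ e₁ e₂) s') := by
  have hi : initList (compTM2 M₁ M₂ e₁ e₂) s = compCfg M₁ M₂ e₁ e₂ (some (Sum.inl M₁.main))
      (M₁.initialState, M₂.initialState, none) (initList M₁ s).stk (fun _ => []) [] := by
    have h := initList_stk (compTM2 M₁ M₂ e₁ e₂) s
    rw [compCfg, initList_stk, compStk_update_left,
      show initList (compTM2 M₁ M₂ e₁ e₂) s =
        ⟨_, _, (initList (compTM2 M₁ M₂ e₁ e₂) s).stk⟩ from rfl, h]
    refine congrArg (fun S => (⟨_, _, Function.update S _ _⟩ : (compTM2 M₁ M₂ e₁ e₂).Cfg)) ?_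
    funext k
    rcases k with _ | k | k <;> rfl
  have hh : haltList (compTM2 M₁ M₂ e₁ e₂) s' = compCfg M₁ M₂ e₁ e₂ none
      (M₁.initialState, M₂.initialState, none) (fun _ => []) (haltList M₂ s').stk [] := by
    have h := haltList_stk (compTM2 M₁ M₂ e₁ e₂) s'
    rw [compCfg, haltList_stk, compStk_update_right,
      show haltList (compTM2 M₁ M₂ e₁ e₂) s' =
        ⟨_, _, (haltList (compTM2 M₁ M₂ e₁ e₂) s').stk⟩ from rfl, h]
    refine congrArg (fun S => (⟨_, _, Function.update S _ _⟩ : (compTM2 M₁ M₂ e₁ e₂).Cfg)) ?_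
    funext k
    rcases k with _ | k | k <;> rfl
  have ho := compTM2_out M₁ M₂ e₁ e₂ M₁.initialState M₂.initialState none (fun _ => [])
    (w.map e₁.symm) []
  have hb := compTM2_back M₁ M₂ e₁ e₂ M₁.initialState M₂.initialState none (fun _ => [])
    [] w.reverse
  have hl := compTM2_left M₁ M₂ e₁ e₂ h₁
  have hr := compTM2_right M₁ M₂ e₁ e₂ h₂
  rw [haltList_stk] at hl
  rw [initList_stk] at hr
  rw [hi, hh]
  refine iterate_bind_trans hl ?_
  rw [show 4 * w.length + 2 + n = (2 * w.length + 1) + ((2 * w.length + 1) + n) by ring]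
  simp only [List.length_map, List.map_map, Equiv.self_comp_symm, List.map_id, List.append_nil,
    List.map_reverse, List.reverse_reverse, List.length_reverse] at ho hb
  rw [update_nil] at hb
  exact iterate_bind_trans ho (iterate_bind_trans hb hr)

end Composition

theorem eval_mono_nat (P : Polynomial ℕ) {m n : ℕ} (h : m ≤ n) : P.eval m ≤ P.eval n := by
  rw [Polynomial.eval_eq_sum, Polynomial.eval_eq_sum]
  exact Finset.sum_le_sum fun i _ => Nat.mul_le_mul_left _ (Nat.pow_le_pow_left h i)

/-- Polynomial time computations can be composed. -/
theorem PolyComputes.comp {ι Γ₀ Γ₁ Γ₂ : Type} [Fintype Γ₁] {ea : ι → List Γ₀} {eb : ι → List Γ₁}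
    {ec : ι → List Γ₂} (h₁ : PolyComputes ea eb) (h₂ : PolyComputes eb ec) :
    PolyComputes ea ec := by
  obtain ⟨⟨⟨M₁, i₁, o₁⟩, P₁, H₁⟩⟩ := h₁
  obtain ⟨⟨⟨M₂, i₂, o₂⟩, P₂, H₂⟩⟩ := h₂
  -- The polynomial `X + P₁ * C M₁.pushBound` bounds the length of the intermediate word; it enters
  -- the two transfer phases and the argument of `P₂`.
  refine ⟨⟨⟨compTM2 M₁ M₂ o₁ i₂, i₁, o₂⟩, P₁ + 4 * (Polynomial.X + P₁ * Polynomial.C M₁.pushBound)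
    + 2 + P₂.comp (Polynomial.X + P₁ * Polynomial.C M₁.pushBound), fun i => ?_⟩⟩
  obtain ⟨⟨m, hm⟩, hm'⟩ := H₁ i
  obtain ⟨⟨n, hn⟩, hn'⟩ := H₂ i
  have hw : (eb i).length ≤ (ea i).length + P₁.eval (ea i).length * M₁.pushBound := by
    have h := M₁.length_iterate_le M₁.k₁ hm
    rw [initList_stk, haltList_stk, Function.update_self, List.length_map] at h
    refine h.trans (add_le_add ?_ (Nat.mul_le_mul_right _ hm'))
    -- The output stack may be the input stack and then initially holds the input; otherwise it is
    -- initially empty.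
    by_cases hk : M₁.k₁ = M₁.k₀
    · rw [hk, Function.update_self, List.length_map]
    · rw [Function.update_of_ne hk]; simp
  refine ⟨⟨m + (4 * (eb i).length + 2 + n), compTM2_outputs M₁ M₂ o₁ i₂ hm hn⟩, ?_⟩
  have h2 := eval_mono_nat P₂ hw
  simp only [Polynomial.eval_add, Polynomial.eval_mul, Polynomial.eval_X, Polynomial.eval_C,
    Polynomial.eval_comp, Polynomial.eval_ofNat] at hm' hn' ⊢
  omega

end Turing

/-! ### Running times of loops, and loops that act as transducers. -/

namespace StackProgram

open Function

variable {K α : Type}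

namespace Prog

/-- Pop symbols from the stack `k` and run `f` on them, until a symbol violates `p` or the stack is
empty. -/
def scan (k : K) (f : α → Prog K α) (p : α → Bool) : Prog K α :=
  loop k (fun x => x.elim skip f) (fun x => x.elim false p)

/-- Pop all symbols of the stack `k` and run `f` on them. -/
def each (k : K) (f : α → Prog K α) : Prog K α :=
  scan k f fun _ => true

/-- Run a program `n` times. -/
def rep (p : Prog K α) : ℕ → Prog K α
  | 0 => skip
  | n + 1 => seq p (rep p n)

end Prog

open Prog

variable [DecidableEq K] {S S' S'' : K → List α} {k k' : K} {f : α → Prog K α} {p : α → Bool}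
  {t t' : ℕ} {x : α} {w r : List α}

theorem runs_scan_nil (h : S k = []) : Runs (scan k f p) S S 1 := by
  have h1 : update S k (S k).tail = S := by rw [h, List.tail_nil, ← h, update_eq_self]
  refine Runs.last (t := 0) (by rw [h]; rfl) ?_
  rw [h1, h]
  exact Runs.skip S

theorem runs_scan_last (h : S k = x :: r) (hx : p x = false)
    (hf : Runs (f x) (update S k r) S' t) : Runs (scan k f p) S S' (t + 1) :=
  Runs.last (by rw [h]; exact hx) (by rw [h]; exact hf)

theorem runs_scan_more (h : S k = x :: r) (hx : p x = true)
    (hf : Runs (f x) (update S k r) S' t) (hs : Runs (scan k f p) S' S'' t') :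
    Runs (scan k f p) S S'' (t + 1 + t') :=
  Runs.more (by rw [h]; exact hx) (by rw [h]; exact hf) hs

theorem runs_rep {q : Prog K α} (T : ℕ → K → List α) (t : ℕ)
    (h : ∀ n, Runs q (T n) (T (n + 1)) t) (n : ℕ) : Runs (rep q n) (T 0) (T n) (n * t) := by
  suffices H : ∀ m, Runs (Prog.rep q n) (T m) (T (m + n)) (n * t) by simpa using H 0
  induction n with
  | zero => intro m; rw [Nat.zero_mul]; exact Runs.skip _
  | succ n ih =>
    intro m
    have := (h m).seq (ih (m + 1))
    rw [Nat.succ_mul, Nat.add_comm (n * t)]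
    rwa [show m + 1 + n = m + (n + 1) by omega] at this

theorem runs_scan_push (hk : k ≠ k') (h : S k = w ++ x :: r) (hw : ∀ y ∈ w, p y = true)
    (hx : p x = false) :
    Runs (scan k (push k') p) S (update (update S k r) k' (x :: (w.reverse ++ S k')))
      (2 * (w.length + 1)) := by
  induction w generalizing S with
  | nil =>
    have := runs_scan_last h hx (Runs.push k' x (update S k r))
    rwa [update_of_ne hk.symm] at this
  | cons y w ih =>
    have h1 := Runs.push k' y (update S k (w ++ x :: r))
    rw [update_of_ne hk.symm] at h1
    have h2 := @ih (update (update S k (w ++ x :: r)) k' (y :: S k'))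
      (by rw [update_of_ne hk, update_self]) fun z hz => hw z (List.mem_cons_of_mem _ hz)
    have h3 := runs_scan_more h (hw y List.mem_cons_self) h1 h2
    rw [update_comm hk.symm, update_idem, update_idem, update_self] at h3
    refine Runs.mono (t := 1 + 1 + 2 * (w.length + 1)) ?_ (by simp; omega)
    simpa [update_comm hk] using h3

theorem runs_each_push (hk : k ≠ k') (h : S k = w) :
    Runs (each k (push k')) S (update (update S k []) k' (w.reverse ++ S k'))
      (2 * w.length + 1) := by
  induction w generalizing S with
  | nil =>
    have := runs_scan_nil (f := push k') (p := fun _ => true) h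
    rw [List.reverse_nil, List.nil_append, (update_eq_self_iff (f := S) (a := k)).2 h.symm, update_eq_self]
    exact this
  | cons y w ih =>
    have h1 := Runs.push k' y (update S k w)
    rw [update_of_ne hk.symm] at h1
    have h2 := @ih (update (update S k w) k' (y :: S k')) (by rw [update_of_ne hk, update_self])
    have h3 := runs_scan_more h rfl h1 h2
    rw [update_comm hk.symm, update_idem, update_idem, update_self] at h3
    refine Runs.mono (t := 1 + 1 + (2 * w.length + 1)) ?_ (by simp; omega)
    simpa [update_comm hk, each] using h3

theorem runs_each_push_push {k'' : K} (hk : k ≠ k') (hk' : k ≠ k'') (hkk : k' ≠ k'')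
    (h : S k = w) :
    Runs (each k fun x => seq (push k' x) (push k'' x)) S
      (update (update (update S k []) k' (w.reverse ++ S k')) k'' (w.reverse ++ S k''))
      (3 * w.length + 1) := by
  induction w generalizing S with
  | nil =>
    have := runs_scan_nil (f := fun x => seq (push k' x) (push k'' x)) (p := fun _ => true) h
    rw [List.reverse_nil, List.nil_append, List.nil_append, (update_eq_self_iff (f := S) (a := k)).2 h.symm,
      update_eq_self, update_eq_self]
    exact this
  | cons y w ih =>
    have h1 := (Runs.push k' y (update S k w)).seq (Runs.push k'' y _)
    rw [update_of_ne hk.symm, update_of_ne hkk.symm, update_of_ne hk'.symm] at h1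
    have h2 := @ih _ (by
      rw [update_of_ne hk', update_of_ne hk, update_self] :
        update (update (update S k w) k' (y :: S k')) k'' (y :: S k'') k = w)
    have h3 := runs_scan_more (f := fun x => seq (push k' x) (push k'' x))
      (p := fun _ => true) h rfl h1 h2
    refine Runs.mono (t := 1 + 1 + 1 + (3 * w.length + 1)) ?_ (by simp; omega)
    convert! h3 using 1
    funext j
    by_cases h'' : j = k''
    · subst h''; simp
    by_cases h' : j = k'
    · subst h'; simp [hkk]
    by_cases h0 : j = k
    · subst h0; simp [hk, hk']
    · simp [h0, h', h'']

theorem runs_each_skip (h : S k = w) :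
    Runs (each k fun _ => skip) S (update S k []) (w.length + 1) := by
  induction w generalizing S with
  | nil =>
    have := runs_scan_nil (f := fun _ => skip) (p := fun _ => true) h
    rw [(update_eq_self_iff (f := S) (a := k)).2 h.symm]
    exact this
  | cons y w ih =>
    have h3 := runs_scan_more (f := fun _ => skip) (p := fun _ => true) h rfl
      (Runs.skip _) (@ih (update S k w) (update_self ..))
    rw [update_idem] at h3
    exact h3.mono (by simp; omega)

/-- In a context `st` of an input stack and an output stack (with top of the output on the left),
the program `p` can start by consuming `w` and emitting `v`, in time at most `c` times the length of
`w`. -/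
def Transduces (q : Prog K α) (st : List α → List α → K → List α) (c : ℕ) (w v : List α) : Prop :=
  ∀ r o S' t, Runs q (st r (v.reverse ++ o)) S' t → Runs q (st (w ++ r) o) S' (t + c * w.length)

theorem Transduces.nil (q : Prog K α) (st : List α → List α → K → List α) (c : ℕ) :
    Transduces q st c [] [] :=
  fun _ _ _ _ h => h

/-- Since `Transduces` speaks about prolonging a given run at its beginning, blocks are chained by
composing implications and no run of the loop has to be cut in the middle. -/
theorem Transduces.append {q : Prog K α} {st : List α → List α → K → List α} {c : ℕ}
    {w v w' v' : List α} (h : Transduces q st c w v) (h' : Transduces q st c w' v') :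
    Transduces q st c (w ++ w') (v ++ v') := by
  intro r o S' t H
  rw [List.reverse_append, List.append_assoc] at H
  rw [List.append_assoc]
  exact (h _ _ _ _ (h' _ _ _ _ H)).mono (by rw [List.length_append]; ring_nf; rfl)

theorem Transduces.flatMap {β : Type} {q : Prog K α} {st : List α → List α → K → List α} {c : ℕ}
    (l : List β) {f g : β → List α} (h : ∀ b ∈ l, Transduces q st c (f b) (g b)) :
    Transduces q st c (l.flatMap f) (l.flatMap g) := by
  induction l with
  | nil => exact Transduces.nil q st c
  | cons b l ih =>
    exact (h b List.mem_cons_self).append (ih fun b' hb' => h b' (List.mem_cons_of_mem _ hb'))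

end StackProgram

namespace StackProgram

open Function

variable {K α : Type}

open Prog

/-- A program that loops over an input stack transduces as soon as each pass does, where each pass
starts by putting the first symbol back. -/
theorem Transduces.of_unread [DecidableEq K] {k : K} {f : α → Prog K α} {p : α → Bool} {x : α}
    {q : Prog K α} {st : List α → List α → K → List α} {c : ℕ} {W v : List α}
    (hst : ∀ i o, st i o k = i) (hW : W.head? = some x) (hx : p x = true)
    (hf : f x = (push k x).seq q)
    (h : ∀ r o, ∃ t, t + 2 ≤ c * W.length ∧ Runs q (st (W ++ r) o) (st r (v.reverse ++ o)) t) :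
    Transduces (scan k f p) st c W v := by
  obtain ⟨w, rfl⟩ : ∃ w, W = x :: w := by
    cases W with
    | nil => cases hW
    | cons y w => exact ⟨w, by simpa using hW⟩
  intro r o S' t H
  obtain ⟨t', ht', h'⟩ := h r o
  have h1 := Runs.push k x (update (st (x :: (w ++ r)) o) k (w ++ r))
  have h0 : update (st (x :: (w ++ r)) o) k (x :: (w ++ r)) = st (x :: (w ++ r)) o :=
    update_eq_self_iff.2 (hst _ _).symm
  rw [update_self, update_idem, h0] at h1
  refine (runs_scan_more (hst _ _) hx ?_ H).mono (t := 1 + t' + 1 + t) (by omega)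
  rw [hf]
  exact h1.seq h'

/-- Registers. -/
inductive Reg : Type
  | inp | out | a | b | c | d | l | r
  deriving DecidableEq

instance : Fintype Reg where
  elems := {.inp, .out, .a, .b, .c, .d, .l, .r}
  complete := by intro x; cases x <;> simp

/-- Stacks given by the contents of the registers. -/
def regs (i o a b c d l r : List α) : Reg → List α
  | .inp => i
  | .out => o
  | .a => a
  | .b => b
  | .c => c
  | .d => d
  | .l => l
  | .r => r

section regs

variable (i o a b c d l r x : List α)

@[simp] theorem regs_inp : regs i o a b c d l r .inp = i := rfl
@[simp] theorem regs_out : regs i o a b c d l r .out = o := rfl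
@[simp] theorem regs_a : regs i o a b c d l r .a = a := rfl
@[simp] theorem regs_b : regs i o a b c d l r .b = b := rfl
@[simp] theorem regs_c : regs i o a b c d l r .c = c := rfl
@[simp] theorem regs_d : regs i o a b c d l r .d = d := rfl
@[simp] theorem regs_l : regs i o a b c d l r .l = l := rfl
@[simp] theorem regs_r : regs i o a b c d l r .r = r := rfl

@[simp] theorem update_regs_inp :
    update (regs i o a b c d l r) .inp x = regs x o a b c d l r := by
  funext j; cases j <;> rfl
@[simp] theorem update_regs_out :
    update (regs i o a b c d l r) .out x = regs i x a b c d l r := by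
  funext j; cases j <;> rfl
@[simp] theorem update_regs_a :
    update (regs i o a b c d l r) .a x = regs i o x b c d l r := by
  funext j; cases j <;> rfl
@[simp] theorem update_regs_b :
    update (regs i o a b c d l r) .b x = regs i o a x c d l r := by
  funext j; cases j <;> rfl
@[simp] theorem update_regs_c :
    update (regs i o a b c d l r) .c x = regs i o a b x d l r := by
  funext j; cases j <;> rfl
@[simp] theorem update_regs_d :
    update (regs i o a b c d l r) .d x = regs i o a b c x l r := by
  funext j; cases j <;> rfl
@[simp] theorem update_regs_l :
    update (regs i o a b c d l r) .l x = regs i o a b c d x r := by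
  funext j; cases j <;> rfl
@[simp] theorem update_regs_r :
    update (regs i o a b c d l r) .r x = regs i o a b c d l x := by
  funext j; cases j <;> rfl

end regs

theorem update_nil_inp (w : List α) :
    update (fun _ => []) Reg.inp w = regs w [] [] [] [] [] [] [] := by
  funext j; cases j <;> rfl

/-- Output a copy of the register `a`, without changing it; the register `b` is used. -/
def echo : Prog Reg α :=
  (each .a (push .b)).seq (each .b fun x => (push .a x).seq (push .out x))

/-- A block read into `a` has its last symbol on top, the same orientation as the output stack.
Passing through `b` reverses it twice, so `w` itself lands on the output. -/
theorem runs_echo (i o w c d l r : List α) :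
    Runs echo (regs i o w [] c d l r) (regs i (w ++ o) w [] c d l r) (5 * w.length + 2) := by
  have h1 := runs_each_push (S := regs i o w [] c d l r) (k := .a) (k' := .b) (by decide) rfl
  have h2 := runs_each_push_push (S := regs i o [] w.reverse c d l r) (k := .b) (k' := .a)
    (k'' := .out) (by decide) (by decide) (by decide) rfl
  simp only [update_regs_a, update_regs_b, update_regs_out, regs_a, regs_b, regs_out,
    List.append_nil, List.reverse_reverse] at h1 h2
  exact (h1.seq h2).mono (by simp; omega)

end StackProgram

/-! ### Programs that copy treatment samples and take disjunctions of groups of bits. -/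

namespace FineBalance

open StackProgram StackProgram.Prog

/-- One symbol of lookahead tells a loop whether another numeral follows or its list has ended with
`semi`. -/
theorem head?_unary_append (m : ℕ) (w : List InSymbol) :
    ∃ x, (unary m ++ w).head? = some x ∧ (x != InSymbol.semi) = true := by
  cases m with
  | zero => exact ⟨.comma, rfl, rfl⟩
  | succ m => exact ⟨.tick, rfl, rfl⟩

theorem length_unary (m : ℕ) : (unary m).length = m + 1 := by
  simp [unary]

/-- Move a unary numeral from the input to another register. -/
def readTo (k : Reg) : Prog Reg InSymbol :=
  scan .inp (push k) (· != .comma)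

theorem runs_readTo {k : Reg} (hk : .inp ≠ k) {S : Reg → List InSymbol} {m : ℕ}
    {r : List InSymbol} (h : S .inp = unary m ++ r) :
    Runs (readTo k) S (Function.update (Function.update S .inp r) k ((unary m).reverse ++ S k))
      (2 * (unary m).length) := by
  have := runs_scan_push (p := (· != InSymbol.comma)) (k' := k) (S := S) (k := .inp)
    (w := List.replicate m .tick) (x := .comma) (r := r) hk (by simpa [unary] using h)
    (by simp) rfl
  simpa [unary, readTo] using this

section Copies

/-- Output `κ` copies of a block that is read into the register `a`. -/
def copyBlock (κ : ℕ) (read : Prog Reg InSymbol) : Prog Reg InSymbol :=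
  read.seq ((rep echo κ).seq (each .a fun _ => skip))

theorem runs_copyBlock (κ : ℕ) {read : Prog Reg InSymbol} {W r o : List InSymbol}
    (h : Runs read (regs (W ++ r) o [] [] [] [] [] []) (regs r o W.reverse [] [] [] [] [])
      (2 * W.length)) :
    Runs (copyBlock κ read) (regs (W ++ r) o [] [] [] [] [] [])
      (regs r (((List.replicate κ W).flatten).reverse ++ o) [] [] [] [] [] [])
      (3 * W.length + 1 + κ * (5 * W.length + 2)) := by
  have h1 := runs_rep (q := echo)
    (fun n => regs r ((List.replicate n W.reverse).flatten ++ o) W.reverse [] [] [] [] [])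
    (5 * W.length + 2) (fun n => by
      have := runs_echo r ((List.replicate n W.reverse).flatten ++ o) W.reverse [] [] [] []
      simpa [List.replicate_succ] using this) κ
  have h2 := runs_each_skip (k := .a)
    (S := regs r ((List.replicate κ W.reverse).flatten ++ o) W.reverse [] [] [] [] []) rfl
  simp only [update_regs_a, regs_a, List.length_reverse] at h2
  have hr : (List.replicate κ W).flatten.reverse = (List.replicate κ W.reverse).flatten := by
    simp [List.reverse_flatten]
  rw [hr]
  exact (h.seq (h1.seq h2)).mono (by omega)

/-- Output the treatment samples, `κ` times each. -/
def copyTreatments (κ : ℕ) : Prog Reg InSymbol :=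
  scan .inp (fun x => if x = .semi then push .out x else
    (push .inp x).seq (copyBlock κ ((readTo .a).seq (readTo .a)))) (· != .semi)

/-- Output the distances in the record of a control sample, `κ` times each. -/
def copyDistances (κ : ℕ) : Prog Reg InSymbol :=
  scan .inp (fun x => if x = .semi then push .out x else
    (push .inp x).seq (copyBlock κ (readTo .a))) (· != .semi)

/-- Output the records of the control samples, with `κ` copies of every distance. -/
def copyControls (κ : ℕ) : Prog Reg InSymbol :=
  each .inp fun x => (push .inp x).seq
    ((readTo .out).seq ((readTo .out).seq (copyDistances κ)))

/-- Reduction of `κ`-BM to BM. -/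
def copyProg (κ : ℕ) : Prog Reg InSymbol :=
  (readTo .out).seq ((copyTreatments κ).seq ((copyControls κ).seq (each .out (push .inp))))

variable (κ : ℕ)

/-- Contexts in which only input and output are in use. -/
abbrev ioRegs {α : Type} (i o : List α) : Reg → List α := regs i o [] [] [] [] [] []

theorem transduces_copyTreatments (m m' : ℕ) :
    Transduces (copyTreatments κ) ioRegs (7 * κ + 6) (unary m ++ unary m')
      (List.replicate κ (unary m ++ unary m')).flatten := by
  obtain ⟨x, hx, hx'⟩ := head?_unary_append m (unary m')
  refine Transduces.of_unread (fun _ _ => rfl) hx hx' (if_neg (by simpa using hx'))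
    fun r o => ⟨_, ?_, runs_copyBlock κ ?_⟩
  -- The block is nonempty, so the additive terms `2 * κ + 3` are absorbed into the rate `7 * κ + 6`
  -- per symbol.
  · have : 0 < (unary m ++ unary m').length := by simp [length_unary]
    nlinarith
  · have h1 := runs_readTo (k := .a) (by decide) (S := ioRegs (unary m ++ unary m' ++ r) o)
      (m := m) (r := unary m' ++ r) (by simp)
    have h2 := runs_readTo (k := .a) (by decide)
      (S := regs (unary m' ++ r) o (unary m).reverse [] [] [] [] []) (m := m') (r := r) rfl
    simp only [update_regs_inp, update_regs_a, regs_a, List.append_nil] at h1 h2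
    simpa [Nat.mul_add] using h1.seq h2

theorem transduces_copyDistances (m : ℕ) :
    Transduces (copyDistances κ) ioRegs (7 * κ + 6) (unary m)
      (List.replicate κ (unary m)).flatten := by
  obtain ⟨x, hx, hx'⟩ := head?_unary_append m []
  rw [List.append_nil] at hx
  refine Transduces.of_unread (fun _ _ => rfl) hx hx' (if_neg (by simpa using hx'))
    fun r o => ⟨_, ?_, runs_copyBlock κ ?_⟩
  · have : 0 < (unary m).length := by simp [length_unary]
    nlinarith
  · have h1 := runs_readTo (k := .a) (by decide) (S := ioRegs (unary m ++ r) o)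
      (m := m) (r := r) rfl
    simpa using h1

theorem transduces_copyControls (m m' : ℕ) (ds : List ℕ) :
    Transduces (copyControls κ) ioRegs (7 * κ + 10)
      (unary m ++ unary m' ++ ds.flatMap unary ++ [.semi])
      (unary m ++ unary m' ++ ds.flatMap (fun d => (List.replicate κ (unary d)).flatten)
        ++ [.semi]) := by
  obtain ⟨x, hx, -⟩ := head?_unary_append m (unary m' ++ ds.flatMap unary ++ [.semi])
  rw [← List.append_assoc, ← List.append_assoc] at hx
  refine Transduces.of_unread (fun _ _ => rfl) hx rfl rfl fun r o => ?_
  have h1 := runs_readTo (k := .out) (by decide)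
    (S := ioRegs (unary m ++ (unary m' ++ (ds.flatMap unary ++ .semi :: r))) o) (m := m) rfl
  have h2 := runs_readTo (k := .out) (by decide)
    (S := ioRegs (unary m' ++ (ds.flatMap unary ++ .semi :: r)) ((unary m).reverse ++ o))
    (m := m') rfl
  have h3 := Transduces.flatMap ds (fun d _ => transduces_copyDistances κ d) (.semi :: r)
    ((unary m').reverse ++ ((unary m).reverse ++ o)) _ _
    (runs_scan_last rfl rfl (Runs.push _ _ _))
  simp only [update_regs_inp, update_regs_out, regs_out] at h1 h2 h3
  refine ⟨2 * (unary m).length + (2 * (unary m').length +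
    (1 + 1 + (7 * κ + 6) * (ds.flatMap unary).length)), ?_, by simpa using h1.seq (h2.seq h3)⟩
  simp only [List.length_append, List.length_singleton]
  nlinarith

theorem length_flatMap_replicate {β : Type} (l : List β) (f : β → List InSymbol) :
    (l.flatMap fun x => (List.replicate κ (f x)).flatten).length = κ * (l.flatMap f).length := by
  induction l with
  | nil => rfl
  | cons x l ih => simp [ih, Nat.mul_add]

theorem length_flatMap_le {β γ : Type} (l : List β) {f g : β → List γ} {c : ℕ}
    (h : ∀ x ∈ l, (f x).length ≤ c * (g x).length) :
    (l.flatMap f).length ≤ c * (l.flatMap g).length := by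
  induction l with
  | nil => simp
  | cons x l ih =>
    have h1 := h x List.mem_cons_self
    have h2 := ih fun y hy => h y (List.mem_cons_of_mem _ hy)
    simp only [List.flatMap_cons, List.length_append, Nat.mul_add]
    omega

/-- Lists of numbers replace the instance, so that loops can be followed by recursion on lists. The
output is produced upside down, and the final loop turns it over onto the input stack. -/
theorem runs_copyProg (k : ℕ) (ts : List (ℕ × ℕ)) (cs : List ((ℕ × ℕ) × List ℕ)) :
    Runs (copyProg κ)
      (ioRegs (unary k ++ ts.flatMap (fun t => unary t.1 ++ unary t.2) ++ [.semi] ++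
        cs.flatMap fun c => unary c.1.1 ++ unary c.1.2 ++ c.2.flatMap unary ++ [.semi]) [])
      (ioRegs (unary k ++ ts.flatMap (fun t =>
        (List.replicate κ (unary t.1 ++ unary t.2)).flatten) ++ [.semi] ++
        cs.flatMap fun c => unary c.1.1 ++ unary c.1.2 ++
          c.2.flatMap (fun d => (List.replicate κ (unary d)).flatten) ++ [.semi]) [])
      ((9 * κ + 12) * (unary k ++ ts.flatMap (fun t : ℕ × ℕ => unary t.1 ++ unary t.2) ++
        [InSymbol.semi] ++ cs.flatMap fun c : (ℕ × ℕ) × List ℕ =>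
          unary c.1.1 ++ unary c.1.2 ++ c.2.flatMap unary ++ [InSymbol.semi]).length + 4) := by
  have ht := length_flatMap_replicate κ ts fun t => unary t.1 ++ unary t.2
  have hc : (cs.flatMap fun c => unary c.1.1 ++ unary c.1.2 ++
      c.2.flatMap (fun d => (List.replicate κ (unary d)).flatten) ++ [.semi]).length ≤
      (κ + 1) * (cs.flatMap fun c => unary c.1.1 ++ unary c.1.2 ++ c.2.flatMap unary ++
        [.semi]).length := by
    refine length_flatMap_le cs fun c _ => ?_
    have := length_flatMap_replicate κ c.2 unary
    simp only [List.length_append, this, List.length_singleton]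
    nlinarith
  have h2 := Transduces.flatMap ts (fun t _ => transduces_copyTreatments κ t.1 t.2)
  have h3 := Transduces.flatMap cs (fun c _ => transduces_copyControls κ c.1.1 c.1.2 c.2)
  generalize (ts.flatMap fun t => (List.replicate κ (unary t.1 ++ unary t.2)).flatten) = T' at *
  generalize (ts.flatMap fun t => unary t.1 ++ unary t.2) = T at *
  generalize (cs.flatMap fun c => unary c.1.1 ++ unary c.1.2 ++
      c.2.flatMap (fun d => (List.replicate κ (unary d)).flatten) ++ [.semi]) = C' at *
  generalize (cs.flatMap fun c => unary c.1.1 ++ unary c.1.2 ++ c.2.flatMap unary ++ [.semi]) = C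
    at *
  have h1 := runs_readTo (k := .out) (by decide)
    (S := ioRegs (unary k ++ (T ++ .semi :: C)) []) (m := k) rfl
  have h2 := h2 (.semi :: C) (unary k).reverse _ _ (runs_scan_last rfl rfl (Runs.push _ _ _))
  have h3 := h3 [] (.semi :: (T'.reverse ++ (unary k).reverse)) _ _ (runs_scan_nil rfl)
  have h4 := runs_each_push (S := ioRegs [] (C'.reverse ++
    .semi :: (T'.reverse ++ (unary k).reverse))) (k := .out) (k' := .inp) (by decide) rfl
  simp only [update_regs_inp, update_regs_out, regs_out, regs_inp, List.append_nil] at h1 h2 h3 h4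
  have h := h1.seq (h2.seq (h3.seq h4))
  simp only [List.reverse_append, List.reverse_cons, List.reverse_reverse] at h
  simp only [List.append_assoc, List.singleton_append] at h ⊢
  refine h.mono ?_
  simp only [List.length_append, List.length_cons, List.length_reverse] at *
  nlinarith

/-- Output word of a list of bits. -/
def bits (bs : List Bool) : List OutSymbol :=
  bs.map fun b => cond b .one .zero

/-- Output the disjunction of `b` and the next `n` bits of the input. -/
def orBits : ℕ → Bool → Prog Reg OutSymbol
  | 0, b => push .out (cond b .one .zero)
  | n + 1, b => loop .inp (fun x => orBits n (b || x == some .one)) fun _ => false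

/-- Output the disjunctions of groups of `κ` bits. -/
def orLoop (κ : ℕ) : Prog Reg OutSymbol :=
  each .inp fun x => if x = .zero ∨ x = .one then (push .inp x).seq (orBits κ false)
    else push .out x

/-- Translation of answers to BM into answers to `κ`-BM. -/
def orProg (κ : ℕ) : Prog Reg OutSymbol :=
  (orLoop κ).seq (each .out (push .inp))

/-- The group size is a constant, so the partial disjunction is kept in the control of the program:
each level of nesting pops exactly one bit. -/
theorem runs_orBits (bs : List Bool) (b : Bool) (r o : List OutSymbol) :
    Runs (orBits bs.length b) (ioRegs (bits bs ++ r) o)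
      (ioRegs r (cond (b || bs.any id) .one .zero :: o)) (bs.length + 1) := by
  induction bs generalizing b with
  | nil =>
    have := Runs.push .out (cond b OutSymbol.one .zero) (ioRegs r o)
    simpa [orBits, bits] using this
  | cons b' bs ih =>
    refine Runs.last rfl ?_
    have := ih (b || b')
    cases b' <;> simpa [Bool.or_assoc, bits, show (OutSymbol.zero == OutSymbol.one) = false from rfl]
      using this

/-- A pass of the loop starts by looking at a first bit and putting it back, so groups must be
nonempty. -/
theorem transduces_orBits (bs : List Bool) (hb : bs ≠ []) (hκ : bs.length = κ) :
    Transduces (orLoop κ) ioRegs 4 (bits bs) [cond (bs.any id) .one .zero] := by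
  obtain ⟨b, bs, rfl⟩ := List.exists_cons_of_ne_nil hb
  subst hκ
  refine Transduces.of_unread (x := cond b .one .zero) (fun _ _ => rfl) rfl rfl
    (if_pos (by cases b <;> simp)) fun r o => ⟨_, ?_, runs_orBits _ _ _ _⟩
  simp [bits]
  omega

theorem runs_orLoop_push {x : OutSymbol} (hx : ¬ (x = .zero ∨ x = .one)) {r o : List OutSymbol}
    {S' : Reg → List OutSymbol} {t : ℕ} (H : Runs (orLoop κ) (ioRegs r (x :: o)) S' t) :
    Runs (orLoop κ) (ioRegs (x :: r) o) S' (2 + t) := by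
  refine runs_scan_more (k := Reg.inp) (x := x) (r := r) (t := 1) rfl rfl ?_ H
  rw [if_neg hx]
  have := Runs.push .out x (ioRegs r o)
  rw [ioRegs, regs_out, update_regs_out] at this
  rwa [ioRegs, update_regs_inp]

theorem runs_orProg (hκ : κ ≠ 0) (M : List (List (List Bool)))
    (hM : ∀ row ∈ M, ∀ bs ∈ row, bs.length = κ) :
    Runs (orProg κ)
      (ioRegs (M.flatMap fun row => row.flatMap bits ++ [.semi]) [])
      (ioRegs (M.flatMap fun row => bits (row.map fun bs => bs.any id) ++ [.semi]) [])
      (6 * (M.flatMap fun row => row.flatMap bits ++ [OutSymbol.semi]).length + 2) := by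
  have hb : ∀ row : List (List Bool), bits (row.map fun bs => bs.any id) =
      row.flatMap fun bs => [cond (bs.any id) OutSymbol.one .zero] := by
    intro row
    rw [← List.map_eq_flatMap, bits, List.map_map]
    rfl
  simp only [hb]
  have hl : (M.flatMap fun row => row.flatMap (fun bs => [cond (bs.any id) OutSymbol.one .zero])
      ++ [OutSymbol.semi]).length ≤
      1 * (M.flatMap fun row => row.flatMap bits ++ [OutSymbol.semi]).length := by
    refine length_flatMap_le M fun row hr => ?_
    have := length_flatMap_le row (f := fun bs => [cond (bs.any id) OutSymbol.one .zero])
      (g := bits) (c := 1) fun bs hbs => by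
        have := hM row hr bs hbs
        simp [bits]
        omega
    simp only [List.length_append, List.length_singleton] at this ⊢
    omega
  have hs : Transduces (orLoop κ) ioRegs 4 [.semi] [.semi] := fun r o S' t H =>
    (runs_orLoop_push κ (x := .semi) (by simp) H).mono
      (by rw [List.length_singleton]; omega)
  have h1 := Transduces.flatMap M (fun row hr => (Transduces.flatMap row fun bs hbs =>
    transduces_orBits κ bs (by
      rintro rfl
      exact hκ (hM row hr [] hbs).symm) (hM row hr bs hbs)).append
    hs) [] [] _ _ (runs_scan_nil rfl)
  generalize (M.flatMap fun row => row.flatMap (fun bs => [cond (bs.any id) OutSymbol.one .zero])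
      ++ [OutSymbol.semi]) = V at *
  have h2 := runs_each_push (S := ioRegs [] V.reverse) (k := .out) (k' := .inp) (by decide) rfl
  simp only [update_regs_inp, update_regs_out, regs_out, regs_inp, List.append_nil,
    List.reverse_reverse, List.length_reverse] at h1 h2
  exact (h1.seq h2).mono (by omega)

theorem runs_orProg_infeasible :
    Runs (orProg κ) (ioRegs [.infeasible] []) (ioRegs [.infeasible] []) 6 := by
  have h1 := runs_orLoop_push κ (x := .infeasible) (r := []) (o := []) (by simp)
    (runs_scan_nil rfl)
  have h2 := runs_each_push (S := ioRegs [] [OutSymbol.infeasible]) (k := .out) (k' := .inp)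
    (by decide) rfl
  simp only [update_regs_inp, update_regs_out, regs_out, regs_inp] at h1 h2
  exact h1.seq h2

end Copies

end FineBalance

/-! ### The reduction of `κ`-BM to BM by copies. -/

theorem List.finRange_mul_flatMap {β : Type} (m n : ℕ) (F : Fin (m * n) → List β) :
    (List.finRange (m * n)).flatMap F = (List.finRange m).flatMap fun i =>
      (List.finRange n).flatMap fun j => F (finProdFinEquiv (i, j)) := by
  have h : List.finRange (m * n) = (List.finRange m).flatMap fun i =>
      (List.finRange n).map fun j => finProdFinEquiv (i, j) := by
    rw [← List.ofFn_id, List.ofFn_mul, List.flatMap_def, List.ofFn_eq_map]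
    congr 1
    refine List.map_congr_left fun i _ => ?_
    rw [List.ofFn_eq_map]
    refine List.map_congr_left fun j _ => ?_
    ext
    simp [finProdFinEquiv, Nat.mul_comm, Nat.add_comm]
  rw [h, List.flatMap_assoc]
  simp only [List.flatMap_map]

theorem List.finRange_flatMap_const {β : Type} (n : ℕ) (w : List β) :
    ((List.finRange n).flatMap fun _ => w) = (List.replicate n w).flatten := by
  rw [List.flatMap_def, List.map_const', List.length_finRange]

theorem divNat_finProdFinEquiv {m n : ℕ} (i : Fin m) (j : Fin n) :
    (finProdFinEquiv (i, j)).divNat = i :=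
  congrArg Prod.fst (finProdFinEquiv.symm_apply_apply (i, j))

theorem card_filter_divNat {L : Type} [DecidableEq L] (m n : ℕ) (lev : Fin m → L) (q : L) :
    (Finset.univ.filter fun x : Fin (m * n) => lev x.divNat = q).card =
      n * (Finset.univ.filter fun i => lev i = q).card := by
  rw [Finset.card_filter, Finset.card_filter, ← finProdFinEquiv.sum_comp, Fintype.sum_prod_type,
    Finset.mul_sum]
  simp only [divNat_finProdFinEquiv, Finset.sum_const, Finset.card_univ, Fintype.card_fin,
    smul_eq_mul]

namespace FineBalance

open StackProgram StackProgram.Prog Turing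

namespace Instance

variable {k₂ : ℕ} (κ : ℕ) (I : Instance k₂)

/-- The instance with `κ` copies of every treatment sample. -/
@[reducible]
def copies : Instance k₂ where
  n := I.n * κ
  n' := I.n'
  k₁ := I.k₁
  tLevel₁ x := I.tLevel₁ x.divNat
  tLevel₂ x := I.tLevel₂ x.divNat
  cLevel₁ := I.cLevel₁
  cLevel₂ := I.cLevel₂
  dist x j := I.dist x.divNat j

variable {κ I}

/-- Each treatment sample is matched to all partners of its copies. -/
def merge (B : (I.copies κ).Assignment) : I.Assignment :=
  fun i => Finset.univ.biUnion fun r : Fin κ => B (finProdFinEquiv (i, r))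

theorem mem_merge {B : (I.copies κ).Assignment} {i : Fin I.n} {j : Fin I.n'} :
    j ∈ merge B i ↔ ∃ r : Fin κ, j ∈ B (finProdFinEquiv (i, r)) := by
  simp [merge]

theorem matched_merge (B : (I.copies κ).Assignment) : I.matched (merge B) = matched _ B := by
  ext j
  simp only [matched, Finset.mem_biUnion, Finset.mem_univ, true_and, mem_merge]
  constructor
  · rintro ⟨i, r, h⟩
    exact ⟨_, h⟩
  · rintro ⟨x, h⟩
    obtain ⟨⟨i, r⟩, rfl⟩ := finProdFinEquiv.surjective x
    exact ⟨i, r, h⟩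

/-- The fibres of `divNat` have `κ` elements, so copying multiplies every treatment level by exactly
the factor of the `κ`-constraint. -/
theorem fineBalanced_copies {L C : Type} [DecidableEq L] {n : ℕ} {lev : Fin n → L} {lev' : C → L}
    {S : Finset C} :
    FineBalanced 1 (fun x : Fin (n * κ) => lev x.divNat) lev' Finset.univ S ↔
      FineBalanced κ lev lev' Finset.univ S := by
  simp only [FineBalanced, card_filter_divNat, Nat.one_mul]

theorem disjoint_copies {B : (I.copies κ).Assignment} (h : (I.copies κ).Feasible 1 B)
    {i i' : Fin I.n} {r r' : Fin κ} (hir : (i, r) ≠ (i', r')) :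
    Disjoint (B (finProdFinEquiv (i, r))) (B (finProdFinEquiv (i', r'))) :=
  h.disjoint _ _ (finProdFinEquiv.injective.ne hir)

theorem Feasible.merge {B : (I.copies κ).Assignment} (h : (I.copies κ).Feasible 1 B) :
    I.Feasible κ (merge B) where
  card_eq i := by
    rw [Instance.merge, Finset.card_biUnion fun r _ r' _ hr => disjoint_copies h (by simpa using hr)]
    simp [h.card_eq]
  disjoint i i' hi := by
    rw [Instance.merge, Instance.merge, Finset.disjoint_biUnion_left]
    intro r _
    rw [Finset.disjoint_biUnion_right]
    exact fun r' _ => disjoint_copies h (by simp [hi])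
  balanced₁ := by
    rw [matched_merge]
    exact fineBalanced_copies.1 h.balanced₁
  balanced₂ := by
    rw [matched_merge]
    exact fineBalanced_copies.1 h.balanced₂

theorem cost_merge {B : (I.copies κ).Assignment} (h : (I.copies κ).Feasible 1 B) :
    I.cost (merge B) = (I.copies κ).cost B := by
  have : (I.copies κ).cost B = ∑ x : Fin (I.n * κ), ∑ j ∈ B x, I.dist x.divNat j := rfl
  rw [this, ← finProdFinEquiv.sum_comp, Fintype.sum_prod_type]
  simp only [divNat_finProdFinEquiv]
  refine Finset.sum_congr rfl fun i _ => ?_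
  exact Finset.sum_biUnion fun r _ r' _ hr => disjoint_copies h (by simpa using hr)

/-- An arbitrary enumeration of each `A i` hands one partner to each copy of `i`. This surjectivity
carries over both optimality and infeasibility. -/
theorem exists_merge_eq {A : I.Assignment} (h : I.Feasible κ A) :
    ∃ B : (I.copies κ).Assignment, (I.copies κ).Feasible 1 B ∧ merge B = A := by
  have e : ∀ i, Fin κ ≃ A i := fun i =>
    (Fintype.equivFinOfCardEq (by rw [Fintype.card_coe, h.card_eq])).symm
  let B : (I.copies κ).Assignment := fun x =>
    {(e (finProdFinEquiv.symm x).1 (finProdFinEquiv.symm x).2 : Fin I.n')}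
  have hB : ∀ p : Fin I.n × Fin κ, B (finProdFinEquiv p) = {(e p.1 p.2 : Fin I.n')} := by
    intro p
    have h := finProdFinEquiv.symm_apply_apply p
    change {(e (finProdFinEquiv.symm (finProdFinEquiv p)).1
      (finProdFinEquiv.symm (finProdFinEquiv p)).2 : Fin I.n')} = _
    rw [h]
  have hm : merge B = A := by
    funext i
    ext j
    rw [mem_merge]
    constructor
    · rintro ⟨r, hr⟩
      rw [hB, Finset.mem_singleton] at hr
      rw [hr]
      exact (e i r).2
    · intro hj
      refine ⟨(e i).symm ⟨j, hj⟩, ?_⟩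
      rw [hB]
      simp
  refine ⟨B, ⟨fun x => Finset.card_singleton _, fun x x' hx => ?_, ?_, ?_⟩, hm⟩
  · obtain ⟨⟨i, r⟩, rfl⟩ := finProdFinEquiv.surjective x
    obtain ⟨⟨i', r'⟩, rfl⟩ := finProdFinEquiv.surjective x'
    rw [hB, hB, Finset.disjoint_singleton]
    intro he
    dsimp only at he
    by_cases hi : i = i'
    · subst hi
      exact hx (by rw [(e i).injective (Subtype.ext he)])
    · exact Finset.disjoint_left.1 (h.disjoint i i' hi) (e i r).2 (he ▸ (e i' r').2)
  · rw [← matched_merge, hm]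
    exact fineBalanced_copies.2 h.balanced₁
  · rw [← matched_merge, hm]
    exact fineBalanced_copies.2 h.balanced₂

theorem Optimal.merge {B : (I.copies κ).Assignment} (h : (I.copies κ).Optimal 1 B) :
    I.Optimal κ (merge B) := by
  refine ⟨h.1.merge, fun A hA => ?_⟩
  obtain ⟨B', hB', rfl⟩ := exists_merge_eq hA
  rw [cost_merge h.1, cost_merge hB']
  exact h.2 B' hB'

variable (I) in
theorem encode_eq : I.encode = unary I.k₁ ++
    ((List.finRange I.n).map fun i => ((I.tLevel₁ i : ℕ), (I.tLevel₂ i : ℕ))).flatMap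
      (fun t => unary t.1 ++ unary t.2) ++ [.semi] ++
    ((List.finRange I.n').map fun j => (((I.cLevel₁ j : ℕ), (I.cLevel₂ j : ℕ)),
      (List.finRange I.n).map fun i => I.dist i j)).flatMap
        fun c => unary c.1.1 ++ unary c.1.2 ++ c.2.flatMap unary ++ [.semi] := by
  simp only [List.flatMap_map, encode]

variable (κ I) in
theorem encode_copies_eq : (I.copies κ).encode = unary I.k₁ ++
    ((List.finRange I.n).map fun i => ((I.tLevel₁ i : ℕ), (I.tLevel₂ i : ℕ))).flatMap
      (fun t => (List.replicate κ (unary t.1 ++ unary t.2)).flatten) ++ [.semi] ++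
    ((List.finRange I.n').map fun j => (((I.cLevel₁ j : ℕ), (I.cLevel₂ j : ℕ)),
      (List.finRange I.n).map fun i => I.dist i j)).flatMap
        fun c => unary c.1.1 ++ unary c.1.2 ++
          c.2.flatMap (fun d => (List.replicate κ (unary d)).flatten) ++ [.semi] := by
  simp only [List.flatMap_map, encode, List.finRange_mul_flatMap, divNat_finProdFinEquiv,
    List.finRange_flatMap_const]

theorem polyComputes_copies (κ k₂ : ℕ) :
    PolyComputes (encode (k₂ := k₂)) fun I => (I.copies κ).encode := by
  refine PolyComputes.of_runs (copyProg κ) .inp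
    (Polynomial.C (9 * κ + 12) * Polynomial.X + Polynomial.C 4) fun I => ?_
  rw [update_nil_inp, update_nil_inp, encode_copies_eq, encode_eq I]
  simp only [Polynomial.eval_add, Polynomial.eval_mul, Polynomial.eval_X, Polynomial.eval_C]
  exact runs_copyProg κ _ _ _

theorem encodeAssignment_eq (I : Instance k₂) (A : I.Assignment) :
    I.encodeAssignment A = (List.finRange I.n').flatMap fun j =>
      bits ((List.finRange I.n).map fun i => decide (j ∈ A i)) ++ [.semi] := by
  simp only [encodeAssignment, bits, List.map_map]
  congr! 5 with j i
  by_cases h : j ∈ A i <;> simp [h]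

/-- Copies of a sample are consecutive in the order of `Fin (I.n * κ)`, so every row of the
incidence matrix splits into groups of `κ` bits, and merging is the disjunction of each group. -/
theorem exists_answer_of_copies (hκ : κ ≠ 0) {w : List OutSymbol}
    (hw : (I.copies κ).IsAnswer 1 w) :
    ∃ w', I.IsAnswer κ w' ∧
      Runs (orProg κ) (ioRegs w []) (ioRegs w' []) (6 * w.length + 6) := by
  rcases hw with ⟨B, hB, rfl⟩ | ⟨hB, rfl⟩
  · refine ⟨_, .inl ⟨merge B, hB.merge, rfl⟩, ?_⟩
    have h := runs_orProg κ hκ ((List.finRange I.n').map fun j => (List.finRange I.n).map fun i =>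
      (List.finRange κ).map fun r => decide (j ∈ B (finProdFinEquiv (i, r)))) (by simp)
    have h1 : encodeAssignment _ B = ((List.finRange I.n').map fun j =>
        (List.finRange I.n).map fun i => (List.finRange κ).map fun r =>
          decide (j ∈ B (finProdFinEquiv (i, r)))).flatMap
            fun row => row.flatMap bits ++ [.semi] := by
      rw [encodeAssignment_eq, List.flatMap_map]
      refine List.flatMap_congr fun j _ => ?_
      rw [List.flatMap_map]
      simp only [bits, List.map_eq_flatMap, List.finRange_mul_flatMap, List.flatMap_assoc]
    have h2 : I.encodeAssignment (merge B) = ((List.finRange I.n').map fun j =>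
        (List.finRange I.n).map fun i => (List.finRange κ).map fun r =>
          decide (j ∈ B (finProdFinEquiv (i, r)))).flatMap
            fun row => bits (row.map fun bs => bs.any id) ++ [.semi] := by
      rw [encodeAssignment_eq, List.flatMap_map]
      refine List.flatMap_congr fun j _ => ?_
      rw [List.map_map]
      congr 3
      funext i
      rw [Bool.eq_iff_iff]
      simp [mem_merge]
    rw [← h1, ← h2] at h
    exact h.mono (by omega)
  · refine ⟨_, .inr ⟨fun ⟨A, hA⟩ => ?_, rfl⟩, (runs_orProg_infeasible κ).mono (by omega)⟩
    obtain ⟨B, hB', -⟩ := exists_merge_eq hA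
    exact hB ⟨B, hB'⟩

end Instance

/-- Reductions transfer polynomial time algorithms. -/
theorem HasPolyTimeAlgorithm.of_reduction {κ κ' k₂ : ℕ} (red : Instance k₂ → Instance k₂)
    (hred : PolyComputes Instance.encode fun I => (red I).encode) (q : Prog Reg OutSymbol)
    (P : Polynomial ℕ)
    (hq : ∀ I w, (red I).IsAnswer κ w → ∃ w', I.IsAnswer κ' w' ∧
      Runs q (ioRegs w []) (ioRegs w' []) (P.eval w.length))
    (h : HasPolyTimeAlgorithm κ k₂) : HasPolyTimeAlgorithm κ' k₂ := by
  obtain ⟨f, hf, ⟨M⟩⟩ := h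
  choose g hg hg' using fun I => hq I _ (hf (red I))
  -- The given machine is used unchanged; only its family of inputs is restricted to the encodings
  -- of reduced instances.
  refine ⟨g, hg, hred.comp (PolyComputes.comp (eb := fun I => f (red I))
    ⟨⟨M.toTM2ComputableAux, M.time, fun I => M.outputsFun (red I)⟩⟩
    (PolyComputes.of_runs q .inp P fun I => ?_))⟩
  rw [update_nil_inp, update_nil_inp]
  exact hg' I

theorem HasPolyTimeAlgorithm.of_one {κ k₂ : ℕ} (hκ : κ ≠ 0) (h : HasPolyTimeAlgorithm 1 k₂) :
    HasPolyTimeAlgorithm κ k₂ := by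
  refine h.of_reduction (fun I => I.copies κ) (Instance.polyComputes_copies κ k₂) (orProg κ)
    (Polynomial.C 6 * Polynomial.X + Polynomial.C 6) fun I w hw => ?_
  obtain ⟨w', hw', hr⟩ := Instance.exists_answer_of_copies hκ hw
  refine ⟨w', hw', ?_⟩
  simpa only [Polynomial.eval_add, Polynomial.eval_mul, Polynomial.eval_X, Polynomial.eval_C]
    using hr

end FineBalance

/-! ### The padded instance: feasible and optimal solutions. -/

/-- Indices of the first `a` members of a set. -/
def leftPart {a b : ℕ} (S : Finset (Fin (a + b))) : Finset (Fin a) :=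
  Finset.univ.filter fun x => Fin.castAdd b x ∈ S

/-- Indices of the last `b` members of a set. -/
def rightPart {a b : ℕ} (S : Finset (Fin (a + b))) : Finset (Fin b) :=
  Finset.univ.filter fun x => Fin.natAdd a x ∈ S

@[simp]
theorem mem_leftPart {a b : ℕ} {S : Finset (Fin (a + b))} {x : Fin a} :
    x ∈ leftPart S ↔ Fin.castAdd b x ∈ S := by
  simp [leftPart]

@[simp]
theorem mem_rightPart {a b : ℕ} {S : Finset (Fin (a + b))} {x : Fin b} :
    x ∈ rightPart S ↔ Fin.natAdd a x ∈ S := by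
  simp [rightPart]

theorem sum_leftPart_add_sum_rightPart {a b : ℕ} (S : Finset (Fin (a + b)))
    (f : Fin (a + b) → ℕ) :
    ∑ y ∈ S, f y = ∑ x ∈ leftPart S, f (Fin.castAdd b x) +
      ∑ x ∈ rightPart S, f (Fin.natAdd a x) := by
  rw [leftPart, rightPart, Finset.sum_filter, Finset.sum_filter,
    ← Fin.sum_univ_add (f := fun y => if y ∈ S then f y else 0), ← Finset.sum_filter]
  simp

theorem card_leftPart_add_card_rightPart {a b : ℕ} (S : Finset (Fin (a + b))) :
    S.card = (leftPart S).card + (rightPart S).card := by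
  simpa using sum_leftPart_add_sum_rightPart S fun _ => 1

theorem ext_parts {a b : ℕ} {S T : Finset (Fin (a + b))} (h : leftPart S = leftPart T)
    (h' : rightPart S = rightPart T) : S = T := by
  ext y
  induction y using Fin.addCases with
  | left x => rw [← mem_leftPart, h, mem_leftPart]
  | right x => rw [← mem_rightPart, h', mem_rightPart]

namespace FineBalance

open StackProgram StackProgram.Prog Turing

namespace Instance

variable {k₂ : ℕ} (m : ℕ) (I : Instance k₂)

/-- The instance with `m` additional control samples for every treatment sample, placed in front.
These have distance `0` to their owner and a large distance to all other treatment samples, and the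
distances of all other control samples are increased by the same large number. -/
@[reducible]
def padded : Instance k₂ where
  n := I.n
  n' := I.n * m + I.n'
  k₁ := I.k₁
  tLevel₁ := I.tLevel₁
  tLevel₂ := I.tLevel₂
  cLevel₁ := Fin.addCases (fun x => I.tLevel₁ x.divNat) I.cLevel₁
  cLevel₂ := Fin.addCases (fun x => I.tLevel₂ x.divNat) I.cLevel₂
  dist i := Fin.addCases (fun x => if x.divNat = i then 0 else I.encode.length)
    fun j => I.encode.length + I.dist i j

variable {m I}

/-- The word contains every distance in unary, so its length dominates the sum of the whole distance
matrix. This is the use of unary input: the word length serves as the large number and is polynomial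
at the same time. -/
theorem cost_lt_length (B : I.Assignment) : I.cost B < I.encode.length := by
  have h1 : I.cost B ≤ ∑ i, ∑ j, I.dist i j :=
    Finset.sum_le_sum fun i _ => Finset.sum_le_sum_of_subset (Finset.subset_univ _)
  have h2 : ∀ j, ∑ i, I.dist i j ≤
      ((List.finRange I.n).flatMap fun i => unary (I.dist i j)).length := by
    intro j
    rw [List.length_flatMap, ← Fin.sum_univ_def]
    exact Finset.sum_le_sum fun i _ => by rw [length_unary]; omega
  have h3 : ∑ j, ∑ i, I.dist i j ≤ ((List.finRange I.n').flatMap fun j =>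
      unary (I.cLevel₁ j) ++ unary (I.cLevel₂ j)
          ++ ((List.finRange I.n).flatMap fun i => unary (I.dist i j))
          ++ [InSymbol.semi]).length := by
    rw [List.length_flatMap, ← Fin.sum_univ_def]
    refine Finset.sum_le_sum fun j _ => (h2 j).trans ?_
    simp only [List.length_append]
    omega
  rw [Finset.sum_comm] at h1
  simp only [encode, List.length_append, List.length_singleton] at h3 ⊢
  omega

/-- Each treatment sample is also matched to its additional control samples. -/
def pad (B : I.Assignment) : (I.padded m).Assignment := fun i =>
  Finset.univ.filter fun y => Fin.addCases (motive := fun _ => Bool)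
    (fun x => decide (x.divNat = i)) (fun j => decide (j ∈ B i)) y

/-- The additional control samples are removed. -/
def unpad (A : (I.padded m).Assignment) : I.Assignment := fun i => rightPart (A i)

theorem leftPart_pad (B : I.Assignment) (i : Fin I.n) :
    leftPart (pad (m := m) B i) = Finset.univ.filter fun x => x.divNat = i := by
  ext x
  simp [pad]

theorem rightPart_pad (B : I.Assignment) (i : Fin I.n) :
    rightPart (pad (m := m) B i) = B i := by
  ext x
  simp [pad]

theorem leftPart_matched (A : (I.padded m).Assignment) :
    leftPart ((I.padded m).matched A) = Finset.univ.biUnion fun i => leftPart (A i) := by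
  ext x
  rw [mem_leftPart]
  simp [matched]

theorem rightPart_matched (A : (I.padded m).Assignment) :
    rightPart ((I.padded m).matched A) = I.matched (unpad A) := by
  ext x
  rw [mem_rightPart]
  simp [matched, unpad]

theorem card_owned (i : Fin I.n) :
    (Finset.univ.filter fun x : Fin (I.n * m) => x.divNat = i).card = m := by
  rw [card_filter_divNat I.n m (fun i => i) i]
  simp [Finset.filter_eq']

/-- Dummies inherit the levels of their owners. Selecting all of them fills `m` of the `m + 1`
required shares in every level and leaves one share to the real controls. -/
theorem fineBalanced_padded {L : Type} [DecidableEq L] {lev : Fin I.n → L} {lev' : Fin I.n' → L}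
    {S : Finset (Fin (I.n * m + I.n'))} (hS : leftPart S = Finset.univ) :
    FineBalanced (m + 1) lev (Fin.addCases (fun x => lev x.divNat) lev') Finset.univ S ↔
      FineBalanced 1 lev lev' Finset.univ (rightPart S) := by
  refine forall_congr' fun q => ?_
  have hl : leftPart (S.filter fun y => (Fin.addCases (fun x => lev x.divNat) lev' y : L) = q) =
      Finset.univ.filter fun x => lev x.divNat = q := by
    ext x
    have : Fin.castAdd I.n' x ∈ S := by rw [← mem_leftPart, hS]; exact Finset.mem_univ x
    simp [this]
  have hr : rightPart (S.filter fun y => (Fin.addCases (fun x => lev x.divNat) lev' y : L) = q) =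
      (rightPart S).filter fun j => lev' j = q := by
    ext x
    simp
  rw [card_leftPart_add_card_rightPart, hl, hr, card_filter_divNat, Nat.add_mul]
  omega

theorem Feasible.pad {B : I.Assignment} (h : I.Feasible 1 B) :
    (I.padded m).Feasible (m + 1) (pad B) := by
  have hl : leftPart ((I.padded m).matched (Instance.pad B)) = Finset.univ := by
    rw [leftPart_matched]
    ext x
    simp [leftPart_pad]
  have hr : rightPart ((I.padded m).matched (Instance.pad B)) = I.matched B := by
    rw [rightPart_matched]
    congr 1
    funext i
    exact rightPart_pad B i
  refine ⟨fun i => ?_, fun i i' hi => ?_, ?_, ?_⟩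
  · rw [card_leftPart_add_card_rightPart, leftPart_pad, rightPart_pad, card_owned, h.card_eq]
  · rw [Finset.disjoint_left]
    intro y hy hy'
    induction y using Fin.addCases with
    | left x =>
      rw [← mem_leftPart, leftPart_pad, Finset.mem_filter] at hy hy'
      exact hi (hy.2.symm.trans hy'.2)
    | right x =>
      rw [← mem_rightPart, rightPart_pad] at hy hy'
      exact Finset.disjoint_left.1 (h.disjoint i i' hi) hy hy'
  · rw [fineBalanced_padded hl, hr]
    exact h.balanced₁
  · rw [fineBalanced_padded hl, hr]
    exact h.balanced₂

theorem cost_padded (A : (I.padded m).Assignment) :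
    (I.padded m).cost A = ∑ i, (∑ x ∈ leftPart (A i), (if x.divNat = i then 0 else I.encode.length)
      + ∑ j ∈ rightPart (A i), (I.encode.length + I.dist i j)) := by
  refine Finset.sum_congr rfl fun i _ => ?_
  rw [sum_leftPart_add_sum_rightPart]
  simp

theorem cost_pad {B : I.Assignment} (h : I.Feasible 1 B) :
    (I.padded m).cost (pad B) = I.n * I.encode.length + I.cost B := by
  rw [cost_padded, cost]
  simp only [leftPart_pad, rightPart_pad, Finset.sum_add_distrib, Finset.sum_const, h.card_eq]
  have : ∀ i : Fin I.n, ∑ x ∈ Finset.univ.filter (fun x : Fin (I.n * m) => x.divNat = i),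
      (if x.divNat = i then 0 else I.encode.length) = 0 := fun i =>
    Finset.sum_eq_zero fun x hx => if_pos (Finset.mem_filter.1 hx).2
  simp [this]

/-- Of the `I.n * (m + 1)` matched pairs, only those of a dummy with its owner cost less than
`I.encode.length`; the cardinality on the right counts them. -/
theorem length_mul_le_cost {A : (I.padded m).Assignment} (h : (I.padded m).Feasible (m + 1) A) :
    I.encode.length * (I.n * (m + 1)) ≤ (I.padded m).cost A + I.encode.length *
      (Finset.univ.filter fun x : Fin (I.n * m) => Fin.castAdd I.n' x ∈ A x.divNat).card := by
  have h1 : (Finset.univ.filter fun x : Fin (I.n * m) => Fin.castAdd I.n' x ∈ A x.divNat).card =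
      ∑ i, ((leftPart (A i)).filter fun x => x.divNat = i).card := by
    rw [Finset.card_eq_sum_card_fiberwise (f := fun x => x.divNat) (t := Finset.univ)
      fun _ _ => Finset.mem_coe.2 (Finset.mem_univ _)]
    refine Finset.sum_congr rfl fun i _ => congrArg Finset.card ?_
    ext x
    simp only [Finset.mem_filter, Finset.mem_univ, true_and, mem_leftPart]
    constructor
    · rintro ⟨hx, rfl⟩
      exact ⟨hx, rfl⟩
    · rintro ⟨hx, rfl⟩
      exact ⟨hx, rfl⟩
  have h2 : I.n * (m + 1) = ∑ i, (A i).card := by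
    simp [h.card_eq]
  rw [h1, h2, cost_padded, Finset.mul_sum, Finset.mul_sum, ← Finset.sum_add_distrib]
  refine Finset.sum_le_sum fun i _ => ?_
  have h3 : ∑ x ∈ leftPart (A i), (if x.divNat = i then 0 else I.encode.length) +
      I.encode.length * ((leftPart (A i)).filter fun x => x.divNat = i).card =
      I.encode.length * (leftPart (A i)).card := by
    rw [Finset.card_filter, Finset.mul_sum, ← Finset.sum_add_distrib, Finset.card_eq_sum_ones,
      Finset.mul_sum]
    refine Finset.sum_congr rfl fun x _ => ?_
    split_ifs <;> simp
  have h4 : I.encode.length * (rightPart (A i)).card ≤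
      ∑ j ∈ rightPart (A i), (I.encode.length + I.dist i j) := by
    rw [Finset.card_eq_sum_ones, Finset.mul_sum]
    exact Finset.sum_le_sum fun j _ => by omega
  rw [card_leftPart_add_card_rightPart, Nat.mul_add]
  omega

/-- With `N` the word length, a dummy away from its owner leaves at most `I.n * m - 1` free pairs,
so the cost is at least `(I.n + 1) * N`. The solution `pad B` costs `I.n * N + I.cost B`, which is
smaller. -/
theorem Optimal.castAdd_mem {A : (I.padded m).Assignment} (h : (I.padded m).Optimal (m + 1) A)
    {B : I.Assignment} (hB : I.Feasible 1 B) (x : Fin (I.n * m)) :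
    Fin.castAdd I.n' x ∈ A x.divNat := by
  by_contra hx
  have h1 := length_mul_le_cost h.1
  have h2 := h.2 _ hB.pad
  rw [cost_pad hB] at h2
  have h3 := cost_lt_length B
  have h4 : (Finset.univ.filter fun x : Fin (I.n * m) =>
      Fin.castAdd I.n' x ∈ A x.divNat).card < I.n * m := by
    conv_rhs => rw [← Fintype.card_fin (I.n * m), ← Finset.card_univ]
    exact Finset.card_lt_card (Finset.filter_ssubset.2 ⟨x, Finset.mem_univ x, hx⟩)
  nlinarith

/-- Feasibility of BM depends only on the selected controls. Dummies may be matched to wrong samples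
here: the real selected controls are balanced and can be assigned anew by any bijection. -/
theorem exists_feasible_of_leftPart {A : (I.padded m).Assignment}
    (h : (I.padded m).Feasible (m + 1) A)
    (hA : leftPart ((I.padded m).matched A) = Finset.univ) :
    ∃ B : I.Assignment, I.Feasible 1 B := by
  have h1 := (fineBalanced_padded hA).1 h.balanced₁
  have h2 := (fineBalanced_padded hA).1 h.balanced₂
  have hc : ((I.padded m).matched A).card = I.n * (m + 1) := by
    rw [matched, Finset.card_biUnion fun i _ i' _ hi => h.disjoint i i' hi]
    simp [h.card_eq]
  -- Removing all `I.n * m` dummies from the `I.n * (m + 1)` selected controls leaves exactly `I.n`.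
  rw [card_leftPart_add_card_rightPart, hA, Finset.card_univ, Fintype.card_fin, Nat.mul_succ] at hc
  have e : Fin I.n ≃ rightPart ((I.padded m).matched A) :=
    (Fintype.equivFinOfCardEq (by rw [Fintype.card_coe]; omega)).symm
  have hm : I.matched (fun i => {(e i : Fin I.n')}) = rightPart ((I.padded m).matched A) := by
    ext j
    simp only [matched, Finset.mem_biUnion, Finset.mem_univ, true_and, Finset.mem_singleton]
    constructor
    · rintro ⟨i, rfl⟩
      exact (e i).2
    · intro hj
      exact ⟨e.symm ⟨j, hj⟩, (congrArg Subtype.val (e.apply_symm_apply ⟨j, hj⟩)).symm⟩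
  refine ⟨fun i => {(e i : Fin I.n')}, fun i => Finset.card_singleton _, fun i i' hi => ?_, ?_, ?_⟩
  · rw [Finset.disjoint_singleton]
    exact fun he => hi (e.injective (Subtype.ext he))
  · rw [hm]
    exact h1
  · rw [hm]
    exact h2

theorem pad_unpad {A : (I.padded m).Assignment} (h : (I.padded m).Feasible (m + 1) A)
    (hA : ∀ x : Fin (I.n * m), Fin.castAdd I.n' x ∈ A x.divNat) : pad (unpad A) = A := by
  funext i
  refine ext_parts ?_ (rightPart_pad _ _)
  rw [leftPart_pad]
  ext x
  rw [mem_leftPart, Finset.mem_filter]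
  constructor
  · rintro ⟨-, rfl⟩
    exact hA x
  · intro hx
    refine ⟨Finset.mem_univ x, ?_⟩
    by_contra hi
    exact Finset.disjoint_left.1 (h.disjoint _ _ hi) (hA x) hx

/-- It is enough to test whether all dummies are matched, not by whom: this makes BM feasible, and
then optimality sends every dummy to its owner. The costs of `A` and its restriction then differ by
a constant. -/
theorem Optimal.unpad {A : (I.padded m).Assignment} (h : (I.padded m).Optimal (m + 1) A)
    (hA : leftPart ((I.padded m).matched A) = Finset.univ) : I.Optimal 1 (unpad A) := by
  obtain ⟨B, hB⟩ := exists_feasible_of_leftPart h.1 hA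
  have hm := h.castAdd_mem hB
  have hp := pad_unpad h.1 hm
  have hf : I.Feasible 1 (Instance.unpad A) := by
    refine ⟨fun i => ?_, fun i i' hi => ?_, ?_, ?_⟩
    · have := card_leftPart_add_card_rightPart (A i)
      rw [h.1.card_eq, ← hp, leftPart_pad, card_owned, hp] at this
      rw [Instance.unpad]
      omega
    · rw [Finset.disjoint_left]
      intro j hj hj'
      exact Finset.disjoint_left.1 (h.1.disjoint i i' hi) (mem_rightPart.1 hj) (mem_rightPart.1 hj')
    · rw [← rightPart_matched]
      exact (fineBalanced_padded hA).1 h.1.balanced₁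
    · rw [← rightPart_matched]
      exact (fineBalanced_padded hA).1 h.1.balanced₂
  refine ⟨hf, fun B' hB' => ?_⟩
  have := h.2 _ hB'.pad
  rw [cost_pad hB', ← hp, cost_pad hf] at this
  omega

end Instance

end FineBalance

/-! ### The program that tests whether all dummies are matched. -/

namespace StackProgram

open Function

variable {K α : Type} [DecidableEq K]

theorem Runs.length_le {p : Prog K α} {S S' : K → List α} {t : ℕ} (h : Runs p S S' t) (k : K) :
    (S' k).length ≤ (S k).length + t := by
  induction h with
  | skip S => exact le_rfl
  | push k' a S =>
    by_cases hk : k = k'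
    · subst hk; simp
    · simp [hk]
  | seq _ _ ih ih' => omega
  | @last k' body again S S' t _ _ ih =>
    by_cases hk : k = k'
    · subst hk
      rw [update_self, List.length_tail] at ih
      omega
    · rw [update_of_ne hk] at ih
      omega
  | @more k' body again S S' S'' t t' _ _ _ ih ih' =>
    by_cases hk : k = k'
    · subst hk
      rw [update_self, List.length_tail] at ih
      omega
    · rw [update_of_ne hk] at ih
      omega
  | mono _ _ ih => omega

end StackProgram

namespace FineBalance

open StackProgram StackProgram.Prog

section Check

/-- Skip the rest of a row, with `c` ticks on the stack `l` for every bit. -/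
def skipRow (c : ℕ) : Prog Reg OutSymbol :=
  scan .inp (fun x => if x = .semi then skip else rep (push .l .one) c) (· != .semi)

/-- Read a row, with `c` ticks on the stack `l` for every bit, and put a tick on the stack `r` if no
bit is set. -/
def checkRow (c : ℕ) : Prog Reg OutSymbol :=
  scan .inp (fun x => if x = .semi then push .r .one else
    (rep (push .l .one) c).seq (if x = .one then skipRow c else skip)) (· == .zero)

theorem runs_rep_push_l (c : ℕ) (i o n f : List OutSymbol) :
    Runs (rep (push .l .one) c) (regs i o [] [] [] [] n f)
      (regs i o [] [] [] [] (List.replicate c .one ++ n) f) c := by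
  have := runs_rep (q := push Reg.l OutSymbol.one)
    (fun j => regs i o [] [] [] [] (List.replicate j .one ++ n) f) 1 (fun j => by
      have := Runs.push Reg.l OutSymbol.one
        (regs i o [] [] [] [] (List.replicate j .one ++ n) f)
      simpa [List.replicate_succ] using this) c
  simpa using this

theorem runs_skipRow (c : ℕ) (bs : List Bool) (i o n f : List OutSymbol) :
    Runs (skipRow c) (regs (bits bs ++ .semi :: i) o [] [] [] [] n f)
      (regs i o [] [] [] [] (List.replicate (bs.length * c) .one ++ n) f)
      ((c + 1) * bs.length + 1) := by
  induction bs generalizing n with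
  | nil =>
    have := Runs.skip (regs i o [] [] [] [] n f)
    simp only [List.length_nil, Nat.zero_mul, Nat.mul_zero, List.replicate_zero, List.nil_append]
    exact runs_scan_last (k := Reg.inp) (S := regs (.semi :: i) o [] [] [] [] n f)
      (f := fun x => if x = .semi then skip else rep (push .l .one) c) (p := (· != .semi)) rfl rfl
      (by simpa using this)
  | cons b bs ih =>
    have h1 := runs_rep_push_l c (bits bs ++ .semi :: i) o n f
    have h2 := runs_scan_more (k := Reg.inp) (p := (· != .semi))
      (f := fun x => if x = .semi then skip else rep (push .l .one) c)
      (S := regs (cond b .one .zero :: (bits bs ++ .semi :: i)) o [] [] [] [] n f) rfl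
      (by cases b <;> rfl) (by cases b <;> simpa using h1) (ih (List.replicate c .one ++ n))
    rw [← List.append_assoc, List.replicate_append_replicate, ← Nat.succ_mul] at h2
    exact h2.mono (by simp only [List.length_cons]; ring_nf; omega)

theorem runs_checkRow (c : ℕ) (bs : List Bool) (i o n f : List OutSymbol) :
    Runs (checkRow c) (regs (bits bs ++ .semi :: i) o [] [] [] [] n f)
      (regs i o [] [] [] [] (List.replicate (bs.length * c) .one ++ n)
        (if bs.any id then f else .one :: f))
      ((c + 1) * bs.length + 2) := by
  induction bs generalizing n with
  | nil =>
    have := Runs.push Reg.r OutSymbol.one (regs i o [] [] [] [] n f)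
    simp only [regs_r, update_regs_r] at this
    simp only [List.length_nil, Nat.zero_mul, Nat.mul_zero, List.replicate_zero, List.nil_append,
      List.any_nil, Bool.false_eq_true, if_false]
    exact runs_scan_last (k := Reg.inp) (p := (· == .zero))
      (f := fun x => if x = .semi then push .r .one else
        (rep (push .l .one) c).seq (if x = .one then skipRow c else skip))
      (S := regs (.semi :: i) o [] [] [] [] n f) rfl rfl
      (by simpa using this)
  | cons b bs ih =>
    have h1 := runs_rep_push_l c (bits bs ++ .semi :: i) o n f
    cases b with
    | false =>
      have h2 := runs_scan_more (k := Reg.inp) (p := (· == .zero))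
        (f := fun x => if x = .semi then push .r .one else
          (rep (push .l .one) c).seq (if x = .one then skipRow c else skip))
        (S := regs (.zero :: (bits bs ++ .semi :: i)) o [] [] [] [] n f) rfl rfl
        (by simpa using h1.seq (Runs.skip _)) (ih (List.replicate c .one ++ n))
      rw [← List.append_assoc, List.replicate_append_replicate, ← Nat.succ_mul] at h2
      simp only [List.any_cons, id, Bool.false_or]
      exact h2.mono (by simp only [List.length_cons]; ring_nf; omega)
    | true =>
      have h3 := runs_skipRow c bs i o (List.replicate c .one ++ n) f
      rw [← List.append_assoc, List.replicate_append_replicate, ← Nat.succ_mul] at h3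
      have h2 := runs_scan_last (k := Reg.inp) (p := (· == .zero))
        (f := fun x => if x = .semi then push .r .one else
          (rep (push .l .one) c).seq (if x = .one then skipRow c else skip))
        (S := regs (.one :: (bits bs ++ .semi :: i)) o [] [] [] [] n f) rfl rfl
        (by simpa using h1.seq h3)
      simp only [List.any_cons, id, Bool.true_or, if_true]
      exact h2.mono (by simp only [List.length_cons]; ring_nf; omega)

/-- The invariant of the row loop: the flag stack stays empty exactly as long as every row read
contains a set bit. -/
theorem ite_append_eq_nil_iff {bs : List Bool} {D : List (List Bool)} {f : List OutSymbol} :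
    ((if bs.any id = true then f else .one :: f) = [] ∧ ∀ bs ∈ D, bs.any id = true) ↔
      f = [] ∧ ∀ bs' ∈ bs :: D, bs'.any id = true := by
  rw [List.forall_mem_cons]
  by_cases h : bs.any id = true
  · rw [if_pos h]
    tauto
  · rw [if_neg h]
    constructor
    · rintro ⟨h', -⟩
      cases h'
    · rintro ⟨-, h', -⟩
      exact absurd h' h

/-- Read as many rows as there are ticks on the stack `l`. -/
def checkRows : Prog Reg OutSymbol :=
  each .l fun _ => checkRow 0

theorem runs_checkRows (D : List (List Bool)) (i o f : List OutSymbol) :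
    ∃ f', (f' = [] ↔ f = [] ∧ ∀ bs ∈ D, bs.any id = true) ∧
      Runs checkRows (regs (D.flatMap (fun bs => bits bs ++ [.semi]) ++ i) o [] [] [] []
        (List.replicate D.length .one) f) (regs i o [] [] [] [] [] f')
        (3 * (D.flatMap fun bs => bits bs ++ [OutSymbol.semi]).length + 1) := by
  induction D generalizing f with
  | nil => exact ⟨f, by simp, runs_scan_nil rfl⟩
  | cons bs D ih =>
    obtain ⟨f', hf', h'⟩ := ih (if bs.any id then f else .one :: f)
    refine ⟨f', ?_, ?_⟩
    · rw [hf', ite_append_eq_nil_iff]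
    · have h1 := runs_checkRow 0 bs (D.flatMap (fun bs => bits bs ++ [.semi]) ++ i) o
        (List.replicate D.length .one) f
      have h2 := runs_scan_more (k := Reg.l) (p := fun _ => true) (f := fun _ => checkRow 0)
        (S := regs ((bs :: D).flatMap (fun bs => bits bs ++ [.semi]) ++ i) o [] [] [] []
          (List.replicate (bs :: D).length .one) f) rfl rfl (by simpa using h1) h'
      refine h2.mono ?_
      simp only [List.flatMap_cons, List.length_append, bits, List.length_map,
        List.length_singleton]
      omega

/-- Copy the rest of the input. -/
def copyRest : Prog Reg OutSymbol :=
  each .inp (push .out)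

/-- Copy the rest of the input if there is no tick on the stack `r`, and report infeasibility
otherwise. -/
def decideProg : Prog Reg OutSymbol :=
  loop .r (fun x => x.elim copyRest fun _ => (each .r fun _ => skip).seq
    ((each .inp fun _ => skip).seq (push .out .infeasible))) fun _ => false

/-- Translation of answers to `(m + 1)`-BM for the padded instance into answers to BM. -/
def checkProg (m : ℕ) : Prog Reg OutSymbol :=
  (loop .inp (fun x => x.elim skip fun x => (push .inp x).seq
    (if x = .zero ∨ x = .one then (checkRow m).seq
      ((scan .l (fun _ => skip) fun _ => false).seq (checkRows.seq decideProg))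
    else copyRest)) fun _ => false).seq (each .out (push .inp))

theorem runs_copyRest (w o : List OutSymbol) :
    Runs copyRest (ioRegs w o) (ioRegs [] (w.reverse ++ o)) (2 * w.length + 1) := by
  have := runs_each_push (S := ioRegs w o) (k := .inp) (k' := .out) (by decide) rfl
  simp only [update_regs_inp, update_regs_out, regs_inp, regs_out] at this
  exact this

theorem runs_each_out (w : List OutSymbol) :
    Runs (each .out (push .inp)) (ioRegs [] w.reverse) (ioRegs w []) (2 * w.length + 1) := by
  have := runs_each_push (S := ioRegs [] w.reverse) (k := .out) (k' := .inp) (by decide) rfl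
  simpa using this

/-- Words that do not start with a bit are the report of infeasibility and the answers for `n = 0`;
both are already correct answers to BM. -/
theorem runs_checkProg_of_not_bit (m : ℕ) {w : List OutSymbol}
    (hw : ∀ x ∈ w.head?, ¬ (x = .zero ∨ x = .one)) :
    Runs (checkProg m) (ioRegs w []) (ioRegs w []) (4 * w.length + 4) := by
  cases w with
  | nil =>
    exact ((Runs.last (k := Reg.inp) rfl (by simpa using Runs.skip (ioRegs [] []))).seq
      (runs_each_out [])).mono (by simp)
  | cons x w =>
    have hx := hw x rfl
    have h1 := Runs.push Reg.inp x (ioRegs w [])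
    have h2 := runs_copyRest (x :: w) []
    simp only [update_regs_inp, regs_inp, List.append_nil] at h1 h2
    refine ((Runs.last (k := Reg.inp) (S := ioRegs (x :: w) []) (S' := ioRegs [] (x :: w).reverse)
      (t := 1 + (2 * (x :: w).length + 1)) rfl ?_).seq (runs_each_out (x :: w))).mono (by omega)
    simp only [regs_inp, update_regs_inp, List.head?_cons, List.tail_cons, Option.elim_some,
      if_neg hx]
    exact h1.seq h2

theorem runs_decideProg (w f : List OutSymbol) :
    Runs decideProg (regs w [] [] [] [] [] [] f)
      (ioRegs [] (if f = [] then w else [.infeasible]).reverse)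
      (2 * w.length + f.length + 4) := by
  cases f with
  | nil =>
    have := runs_copyRest w []
    rw [List.append_nil] at this
    exact (Runs.last (k := Reg.r) rfl (by simpa using this)).mono (by simp)
  | cons x f =>
    have h1 := runs_each_skip (S := regs w [] [] [] [] [] [] f) (k := .r) rfl
    have h2 := runs_each_skip (S := ioRegs w []) (k := .inp) rfl
    have h3 := Runs.push Reg.out OutSymbol.infeasible (ioRegs [] [])
    simp only [update_regs_inp, update_regs_r, update_regs_out, regs_inp, regs_r, regs_out]
      at h1 h2 h3
    exact (Runs.last (k := Reg.r) rfl (by simpa using h1.seq (h2.seq h3))).mono (by simp; omega)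

/-- The program sees only the answer, not the instance, and must find out where the dummy rows end.
The first row has `n` bits, so `m` ticks per bit count the `n * m` dummy rows. -/
theorem runs_checkProg (m n : ℕ) (hn : n ≠ 0) (hm : m ≠ 0) {D : List (List Bool)}
    (hD : ∀ bs ∈ D, bs.length = n) (hl : D.length = n * m) (w : List OutSymbol) :
    Runs (checkProg m) (ioRegs (D.flatMap (fun bs => bits bs ++ [.semi]) ++ w) [])
      (ioRegs (if ∀ bs ∈ D, bs.any id = true then w else [.infeasible]) [])
      ((m + 30) * (D.flatMap (fun bs => bits bs ++ [OutSymbol.semi]) ++ w).length + 30) := by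
  cases D with
  | nil =>
    have : 0 < n * m := Nat.mul_pos (Nat.pos_of_ne_zero hn) (Nat.pos_of_ne_zero hm)
    simp only [List.length_nil] at hl
    omega
  | cons bs D =>
    obtain ⟨b, bs', hbs⟩ : ∃ b bs', bs = b :: bs' := by
      cases bs with
      | nil => exact absurd (hD [] List.mem_cons_self).symm hn
      | cons b bs' => exact ⟨b, bs', rfl⟩
    set i := D.flatMap (fun bs => bits bs ++ [.semi]) ++ w with hi
    have h1 := Runs.push Reg.inp (cond b .one .zero) (ioRegs (bits bs' ++ .semi :: i) [])
    have hbw : cond b .one .zero :: (bits bs' ++ .semi :: i) = bits bs ++ .semi :: i := by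
      rw [hbs]
      rfl
    have h2 := runs_checkRow m bs i [] [] []
    have hlen : bs.length * m = D.length + 1 := by
      rw [hD bs List.mem_cons_self, ← hl, List.length_cons]
    rw [List.append_nil, hlen] at h2
    -- One tick is dropped for the first row, which has already been read.
    have h3 := runs_scan_last (k := Reg.l) (f := fun _ => skip) (p := fun _ => false)
      (S := regs i [] [] [] [] [] (List.replicate (D.length + 1) .one)
        (if bs.any id then [] else [.one])) rfl rfl (Runs.skip _)
    obtain ⟨f, hf, h4⟩ := runs_checkRows D w [] (if bs.any id then [] else [.one])
    have h5 := runs_decideProg w f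
    have hf' : f = [] ↔ ∀ bs' ∈ bs :: D, bs'.any id = true := by
      rw [hf, ite_append_eq_nil_iff]
      simp only [true_and]
    -- The flags have to be erased later, and their number is bounded by the time spent on producing
    -- them.
    have hfl := h4.length_le .r
    simp only [regs_r] at hfl
    have hfl' : (if bs.any id = true then [] else [OutSymbol.one]).length ≤ 1 := by
      split_ifs <;> simp
    simp only [update_regs_inp, update_regs_l, regs_inp] at h1 h3
    rw [hbw] at h1
    have h6 := h1.seq (h2.seq (h3.seq (h4.seq h5)))
    have h7 := Runs.last (k := Reg.inp) (S := ioRegs (bits bs ++ .semi :: i) [])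
      (body := fun x => x.elim skip fun x => (push .inp x).seq
        (if x = .zero ∨ x = .one then (checkRow m).seq
          ((scan .l (fun _ => skip) fun _ => false).seq (checkRows.seq decideProg))
        else copyRest)) (again := fun _ => false) rfl (by
          rw [← hbw]
          simp only [regs_inp, List.head?_cons, List.tail_cons, Option.elim_some, update_regs_inp]
          rw [if_pos (by cases b <;> simp)]
          exact h6)
    have h8 := h7.seq (runs_each_out _)
    have hw : (bs :: D).flatMap (fun bs => bits bs ++ [.semi]) ++ w = bits bs ++ .semi :: i := by
      simp [hi]
    rw [hw]
    simp only [hf'] at h8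
    refine h8.mono ?_
    have hite : (if ∀ bs' ∈ bs :: D, bs'.any id = true then w else [OutSymbol.infeasible]).length ≤
        w.length + 1 := by
      split_ifs <;> simp
    have hbl : (bits bs).length = bs.length := List.length_map _
    simp only [hi, List.length_append, List.length_cons, hbl] at *
    nlinarith

end Check

end FineBalance

/-! ### Translation of padded answers into answers to BM. -/

theorem List.finRange_add_flatMap {β : Type} (a b : ℕ) (F : Fin (a + b) → List β) :
    (List.finRange (a + b)).flatMap F =
      (List.finRange a).flatMap (fun x => F (Fin.castAdd b x)) ++
        (List.finRange b).flatMap fun x => F (Fin.natAdd a x) := by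
  have h : List.finRange (a + b) =
      (List.finRange a).map (Fin.castAdd b) ++ (List.finRange b).map (Fin.natAdd a) := by
    rw [← List.ofFn_eq_map, ← List.ofFn_eq_map, ← List.ofFn_fin_append, ← List.ofFn_id]
    exact congrArg List.ofFn (Fin.append_castAdd_natAdd (f := fun x => x)).symm
  rw [h, List.flatMap_append, List.flatMap_map, List.flatMap_map]

namespace FineBalance

open StackProgram StackProgram.Prog Turing

namespace Instance

variable {k₂ m : ℕ} {I : Instance k₂}

/-- Dummies are placed in front, so the answer to the original instance is literally a suffix of the
padded answer. -/
theorem encodeAssignment_padded (A : (I.padded m).Assignment) :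
    encodeAssignment _ A = ((List.finRange (I.n * m)).map fun x => (List.finRange I.n).map fun i =>
      decide (Fin.castAdd I.n' x ∈ A i)).flatMap (fun bs => bits bs ++ [.semi]) ++
        I.encodeAssignment (unpad A) := by
  rw [encodeAssignment_eq, encodeAssignment_eq, List.finRange_add_flatMap, List.flatMap_map]
  simp only [unpad, mem_rightPart]

theorem runs_checkProg_encodeAssignment (hm : m ≠ 0) (A : (I.padded m).Assignment)
    [Decidable (leftPart ((I.padded m).matched A) = Finset.univ)] :
    Runs (checkProg m) (ioRegs (encodeAssignment _ A) [])
      (ioRegs (if leftPart ((I.padded m).matched A) = Finset.univ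
        then I.encodeAssignment (unpad A) else [.infeasible]) [])
      ((m + 30) * (encodeAssignment _ A).length + 30) := by
  -- Without treatment samples there are no dummies, and all rows are bare `semi` symbols.
  by_cases hn : I.n = 0
  · have h0 : IsEmpty (Fin (I.n * m)) := by
      rw [hn, Nat.zero_mul]
      infer_instance
    have hl : leftPart ((I.padded m).matched A) = Finset.univ := by
      ext x
      exact h0.elim x
    have he : encodeAssignment _ A = I.encodeAssignment (unpad A) := by
      rw [encodeAssignment_padded, List.append_left_eq_self, List.flatMap_eq_nil_iff]
      intro bs hbs
      obtain ⟨x, -, -⟩ := List.mem_map.1 hbs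
      exact h0.elim x
    rw [if_pos hl, ← he]
    refine (runs_checkProg_of_not_bit m fun x hx => ?_).mono (by nlinarith)
    have hx' : x ∈ encodeAssignment _ A := List.mem_of_mem_head? hx
    rw [encodeAssignment, List.mem_flatMap] at hx'
    obtain ⟨j, -, hj⟩ := hx'
    rw [List.mem_append, List.mem_map, List.mem_singleton] at hj
    rcases hj with ⟨i, -, -⟩ | rfl
    · exact (Nat.not_lt_zero i.val (lt_of_lt_of_eq i.isLt hn)).elim
    · simp
  · have h := runs_checkProg m I.n hn hm
      (D := (List.finRange (I.n * m)).map fun x => (List.finRange I.n).map fun i =>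
        decide (Fin.castAdd I.n' x ∈ A i)) (by simp) (by simp) (I.encodeAssignment (unpad A))
    rw [encodeAssignment_padded]
    convert! h using 3
    rw [Finset.eq_univ_iff_forall]
    simp [matched]

theorem exists_answer_of_padded (hm : m ≠ 0) {w : List OutSymbol}
    (hw : (I.padded m).IsAnswer (m + 1) w) :
    ∃ w', I.IsAnswer 1 w' ∧
      Runs (checkProg m) (ioRegs w []) (ioRegs w' []) ((m + 30) * w.length + 30) := by
  classical
  rcases hw with ⟨A, hA, rfl⟩ | ⟨hA, rfl⟩
  · refine ⟨_, ?_, runs_checkProg_encodeAssignment hm A⟩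
    split_ifs with h
    · exact .inl ⟨_, hA.unpad h, rfl⟩
    -- A feasible `B` would force every dummy to be matched to its owner, contrary to the failed
    -- test.
    · refine .inr ⟨fun ⟨B, hB⟩ => h ?_, rfl⟩
      ext x
      have := hA.castAdd_mem hB x
      simp only [mem_leftPart, matched, Finset.mem_biUnion, Finset.mem_univ, true_and, iff_true]
      exact ⟨_, this⟩
  · exact ⟨_, .inr ⟨fun ⟨B, hB⟩ => hA ⟨_, hB.pad⟩, rfl⟩,
      (runs_checkProg_of_not_bit m (by simp)).mono (by simp)⟩

end Instance

end FineBalance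

/-! ### The program that computes the padded instance. -/

namespace StackProgram

open Function Prog

variable {K α : Type} [DecidableEq K]

/-- Processing of all symbols of a stack, where `T u w` are the stacks when the symbols of `u` (last
one first) have been processed and those of `w` have not. -/
theorem runs_each {k : K} {f : α → Prog K α} {t : ℕ} (T : List α → List α → K → List α)
    (hT : ∀ u w, T u w k = w)
    (hf : ∀ u x w, Runs (f x) (update (T u (x :: w)) k w) (T (x :: u) w) t) (w u : List α) :
    Runs (each k f) (T u w) (T (w.reverse ++ u) []) (w.length * (t + 1) + 1) := by
  induction w generalizing u with
  | nil => exact (runs_scan_nil (hT _ _)).mono (by simp)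
  | cons x w ih =>
    have h := runs_scan_more (p := fun _ => true) (hT u (x :: w)) rfl (hf u x w) (ih (x :: u))
    rw [List.reverse_cons, List.append_assoc, List.singleton_append]
    exact h.mono (by rw [List.length_cons, Nat.succ_mul]; omega)

end StackProgram

namespace FineBalance

open StackProgram StackProgram.Prog Turing

section Pad

/-- Output as many ticks as there are symbols on the stack `c`; the stack `b` is used. -/
def ticks : Prog Reg InSymbol :=
  (each .c fun x => (push .b x).seq (push .out .tick)).seq (each .b (push .c))

theorem runs_ticks (i o a c d l r : List InSymbol) :
    Runs ticks (regs i o a [] c d l r)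
      (regs i (List.replicate c.length .tick ++ o) a [] c d l r) (5 * c.length + 2) := by
  have h1 := runs_each (k := Reg.c) (f := fun x => (push Reg.b x).seq (push .out InSymbol.tick))
    (t := 2) (fun u w => regs i (List.replicate u.length .tick ++ o) a u w d l r)
    (fun _ _ => rfl) (fun u x w => by
      have h1 := Runs.push Reg.b x (regs i (List.replicate u.length .tick ++ o) a u w d l r)
      have h2 := Runs.push Reg.out InSymbol.tick
        (regs i (List.replicate u.length .tick ++ o) a (x :: u) w d l r)
      simp only [update_regs_b, update_regs_out, regs_b, regs_out] at h1 h2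
      simpa [List.replicate_succ] using h1.seq h2) c []
  have h2 := runs_each_push (S := regs i (List.replicate c.length .tick ++ o) a c.reverse
    [] d l r) (k := .b) (k' := .c) (by decide) rfl
  simp only [update_regs_b, update_regs_c, regs_b, regs_c, List.append_nil,
    List.reverse_reverse, List.length_nil, List.replicate_zero, List.nil_append,
    List.length_reverse] at h1 h2
  exact (h1.seq h2).mono (by omega)

/-- Output the large number that is stored on the stack `c`. -/
def large : Prog Reg InSymbol :=
  ticks.seq (push .out .comma)

theorem runs_large (i o a c d l r : List InSymbol) :
    Runs large (regs i o a [] c d l r)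
      (regs i ((unary c.length).reverse ++ o) a [] c d l r) (5 * c.length + 3) := by
  have h2 := Runs.push .out InSymbol.comma
    (regs i (List.replicate c.length .tick ++ o) a [] c d l r)
  simp only [update_regs_out, regs_out] at h2
  have := (runs_ticks i o a c d l r).seq h2
  simpa [unary, large] using this

theorem reverse_flatten_replicate_succ (n : ℕ) (w o : List InSymbol) :
    (List.replicate (n + 1) w).flatten.reverse ++ o =
      w.reverse ++ ((List.replicate n w).flatten.reverse ++ o) := by
  rw [List.replicate_succ', List.flatten_append, List.flatten_singleton, List.reverse_append,
    List.append_assoc]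

theorem runs_each_large_l (i o a c l r : List InSymbol) :
    Runs ((each .l fun x => (push .d x).seq large).seq (each .d (push .l)))
      (regs i o a [] c [] l r)
      (regs i ((List.replicate l.length (unary c.length)).flatten.reverse ++ o) a [] c [] l r)
      (l.length * (5 * c.length + 7) + 2) := by
  have h1 := runs_each (k := Reg.l) (f := fun x => (push Reg.d x).seq large)
    (t := 1 + (5 * c.length + 3)) (fun u w => regs i
      ((List.replicate u.length (unary c.length)).flatten.reverse ++ o) a [] c u w r)
    (fun _ _ => rfl) (fun u x w => by
      have h1 := Runs.push Reg.d x (regs i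
        ((List.replicate u.length (unary c.length)).flatten.reverse ++ o) a [] c u w r)
      have h2 := runs_large i ((List.replicate u.length (unary c.length)).flatten.reverse ++ o) a c
        (x :: u) w r
      simp only [update_regs_d, regs_d] at h1
      rw [List.length_cons, reverse_flatten_replicate_succ, update_regs_l]
      exact h1.seq h2) l []
  have h2 := runs_each_push (S := regs i
    ((List.replicate l.length (unary c.length)).flatten.reverse ++ o) a [] c l.reverse [] r)
    (k := .d) (k' := .l) (by decide) rfl
  simp only [update_regs_d, update_regs_l, regs_d, regs_l, List.append_nil,
    List.reverse_reverse, List.length_nil, List.replicate_zero, List.flatten_nil,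
    List.reverse_nil, List.nil_append, List.length_reverse] at h1 h2
  exact (h1.seq h2).mono (by ring_nf; omega)

theorem runs_each_large_r (i o a c l r : List InSymbol) :
    Runs ((each .r fun x => (push .d x).seq large).seq (each .d (push .r)))
      (regs i o a [] c [] l r)
      (regs i ((List.replicate r.length (unary c.length)).flatten.reverse ++ o) a [] c [] l r)
      (r.length * (5 * c.length + 7) + 2) := by
  have h1 := runs_each (k := Reg.r) (f := fun x => (push Reg.d x).seq large)
    (t := 1 + (5 * c.length + 3)) (fun u w => regs i
      ((List.replicate u.length (unary c.length)).flatten.reverse ++ o) a [] c u l w)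
    (fun _ _ => rfl) (fun u x w => by
      have h1 := Runs.push Reg.d x (regs i
        ((List.replicate u.length (unary c.length)).flatten.reverse ++ o) a [] c u l w)
      have h2 := runs_large i ((List.replicate u.length (unary c.length)).flatten.reverse ++ o) a c
        (x :: u) l w
      simp only [update_regs_d, regs_d] at h1
      rw [List.length_cons, reverse_flatten_replicate_succ, update_regs_r]
      exact h1.seq h2) r []
  have h2 := runs_each_push (S := regs i
    ((List.replicate r.length (unary c.length)).flatten.reverse ++ o) a [] c r.reverse l [])
    (k := .d) (k' := .r) (by decide) rfl
  simp only [update_regs_d, update_regs_r, regs_d, regs_r, List.append_nil,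
    List.reverse_reverse, List.length_nil, List.replicate_zero, List.flatten_nil,
    List.reverse_nil, List.nil_append, List.length_reverse] at h1 h2
  exact (h1.seq h2).mono (by ring_nf; omega)

/-- Distances of a dummy for a treatment sample that has `p` predecessors and `q` successors: `0`
to this sample and `N` to the other ones. -/
def dummyDistances (N p q : ℕ) : List InSymbol :=
  (List.replicate p (unary N)).flatten ++ unary 0 ++ (List.replicate q (unary N)).flatten ++ [.semi]

/-- Output the distances of a dummy, for the numbers on the stacks `c`, `l` and `r`. -/
def putDistances : Prog Reg InSymbol :=
  ((each .l fun x => (push .d x).seq large).seq (each .d (push .l))).seq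
    ((push .out .comma).seq
      (((each .r fun x => (push .d x).seq large).seq (each .d (push .r))).seq (push .out .semi)))

theorem runs_putDistances (i o a c l r : List InSymbol) :
    Runs putDistances (regs i o a [] c [] l r)
      (regs i ((dummyDistances c.length l.length r.length).reverse ++ o) a [] c [] l r)
      ((l.length + r.length) * (5 * c.length + 7) + 6) := by
  have h1 := runs_each_large_l i o a c l r
  have h2 := Runs.push .out InSymbol.comma (regs i
    ((List.replicate l.length (unary c.length)).flatten.reverse ++ o) a [] c [] l r)
  have h3 := runs_each_large_r i (.comma ::
    ((List.replicate l.length (unary c.length)).flatten.reverse ++ o)) a c l r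
  have h4 := Runs.push .out InSymbol.semi (regs i
    ((List.replicate r.length (unary c.length)).flatten.reverse ++ .comma ::
    ((List.replicate l.length (unary c.length)).flatten.reverse ++ o)) a [] c [] l r)
  simp only [update_regs_out, regs_out] at h2 h4
  have h : (dummyDistances c.length l.length r.length).reverse ++ o =
      .semi :: ((List.replicate r.length (unary c.length)).flatten.reverse ++ .comma ::
        ((List.replicate l.length (unary c.length)).flatten.reverse ++ o)) := by
    simp only [dummyDistances, show unary 0 = [.comma] from rfl, List.reverse_append,
      List.append_assoc, List.reverse_cons, List.reverse_nil, List.nil_append, List.cons_append]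
  rw [h]
  exact (h1.seq (h2.seq (h3.seq h4))).mono (by ring_nf; omega)

/-- The two levels of a sample. -/
def levels (t : ℕ × ℕ) : List InSymbol :=
  unary t.1 ++ unary t.2

theorem le_length_levels (t : ℕ × ℕ) : 2 ≤ (levels t).length := by
  rw [levels, List.length_append, length_unary, length_unary]
  omega

theorem exists_levels_append (t : ℕ × ℕ) (w : List InSymbol) :
    ∃ x v, levels t ++ w = x :: v ∧ (x != InSymbol.semi) = true := by
  rcases t with ⟨_ | m, m'⟩
  exacts [⟨.comma, _, rfl, rfl⟩, ⟨.tick, _, rfl, rfl⟩]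

theorem runs_readTo_readTo (t : ℕ × ℕ) (i o c d l r : List InSymbol) :
    Runs ((readTo .a).seq (readTo .a)) (regs (levels t ++ i) o [] [] c d l r)
      (regs i o (levels t).reverse [] c d l r) (2 * (levels t).length) := by
  have h1 := runs_readTo (k := .a) (by decide) (S := regs (levels t ++ i) o [] [] c d l r)
    (m := t.1) (r := unary t.2 ++ i) (by simp [levels])
  have h2 := runs_readTo (k := .a) (by decide)
    (S := regs (unary t.2 ++ i) o (unary t.1).reverse [] c d l r) (m := t.2) (r := i) rfl
  simp only [update_regs_inp, update_regs_a, regs_a, List.append_nil] at h1 h2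
  simpa [levels, Nat.mul_add] using h1.seq h2

/-- Copy the record of a treatment sample to the output and to the stack `d`, and put a tick on the
stack `r`. -/
def treatmentBlock : Prog Reg InSymbol :=
  ((readTo .a).seq (readTo .a)).seq (echo.seq
    ((each .a (push .b)).seq ((each .b (push .d)).seq (push .r .tick))))

theorem runs_treatmentBlock (t : ℕ × ℕ) (i o c d l r : List InSymbol) :
    Runs treatmentBlock (regs (levels t ++ i) o [] [] c d l r)
      (regs i ((levels t).reverse ++ o) [] [] c ((levels t).reverse ++ d) l (.tick :: r))
      (11 * (levels t).length + 5) := by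
  have h1 := runs_readTo_readTo t i o c d l r
  generalize levels t = W at *
  have h2 := runs_echo i o W.reverse c d l r
  have h3 := runs_each_push (S := regs i (W.reverse ++ o) W.reverse [] c d l r) (k := .a) (k' := .b)
    (by decide) rfl
  have h4 := runs_each_push (S := regs i (W.reverse ++ o) [] W c d l r) (k := .b) (k' := .d)
    (by decide) rfl
  have h5 := Runs.push Reg.r InSymbol.tick
    (regs i (W.reverse ++ o) [] [] c (W.reverse ++ d) l r)
  simp only [update_regs_a, update_regs_b, update_regs_d, update_regs_r, regs_a, regs_b, regs_d,
    regs_r, List.append_nil, List.reverse_reverse, List.length_reverse] at h2 h3 h4 h5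
  exact (h1.seq (h2.seq (h3.seq (h4.seq h5)))).mono (by omega)

/-- Plays the role of `Transduces.of_unread` for loops over treatment records, whose passes also
change the registers `d`, `l` and `r`, so that the context is not fixed. -/
theorem runs_unread {f : InSymbol → Prog Reg InSymbol} {q : Prog Reg InSymbol} (t : ℕ × ℕ)
    {i o c d l r : List InSymbol} {S' S'' : Reg → List InSymbol} {n n' : ℕ}
    (hf : ∀ x ≠ InSymbol.semi, f x = (push .inp x).seq q)
    (h : Runs q (regs (levels t ++ i) o [] [] c d l r) S' n)
    (h' : Runs (scan .inp f (· != .semi)) S' S'' n') :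
    Runs (scan .inp f (· != .semi)) (regs (levels t ++ i) o [] [] c d l r) S'' (n + 2 + n') := by
  obtain ⟨x, w, hw, hx⟩ := exists_levels_append t i
  rw [hw] at h ⊢
  have h1 := Runs.push Reg.inp x (regs w o [] [] c d l r)
  simp only [update_regs_inp, regs_inp] at h1
  refine (runs_scan_more (k := Reg.inp) (p := (· != .semi)) (f := f) (x := x) (r := w)
    (S := regs (x :: w) o [] [] c d l r) (S' := S') (t := 1 + n) rfl hx ?_ h').mono (by omega)
  rw [hf x (by simpa using hx), update_regs_inp]
  exact h1.seq h

/-- Copy the records of the treatment samples to the output, and put their number on the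
stack `r`. -/
def copyTreatmentsOnce : Prog Reg InSymbol :=
  (scan .inp (fun x => if x = .semi then (push .out x).seq (push .inp x) else
    (push .inp x).seq treatmentBlock) (· != .semi)).seq (each .d (push .inp))

/-- The treatment records are needed again for the dummies. Hence they are saved on `d` and restored
to the input, including the final `semi`, and their number is left on `r`. -/
theorem runs_copyTreatmentsOnce (N : ℕ) (ts : List (ℕ × ℕ))
    (hN : (ts.flatMap levels).length ≤ N) (i o c : List InSymbol) :
    Runs copyTreatmentsOnce (regs (ts.flatMap levels ++ .semi :: i) o [] [] c [] [] [])
      (regs (ts.flatMap levels ++ .semi :: i) (.semi :: ((ts.flatMap levels).reverse ++ o)) [] []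
        c [] [] (List.replicate ts.length .tick))
      (ts.length * (11 * N + 7) + 2 * N + 4) := by
  have h1 : ∀ ts : List (ℕ × ℕ), (ts.flatMap levels).length ≤ N → ∀ o d r,
      Runs (scan .inp (fun x => if x = .semi then (push .out x).seq (push .inp x) else
        (push .inp x).seq treatmentBlock) (· != .semi))
      (regs (ts.flatMap levels ++ .semi :: i) o [] [] c d [] r)
      (regs (.semi :: i) (.semi :: ((ts.flatMap levels).reverse ++ o)) [] [] c
        ((ts.flatMap levels).reverse ++ d) [] (List.replicate ts.length .tick ++ r))
      (ts.length * (11 * N + 7) + 3) := by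
    intro ts
    induction ts with
    | nil =>
      intro _ o d r
      have h1 := Runs.push Reg.out InSymbol.semi (regs i o [] [] c d [] r)
      have h2 := Runs.push Reg.inp InSymbol.semi (regs i (.semi :: o) [] [] c d [] r)
      simp only [update_regs_out, update_regs_inp, regs_out, regs_inp] at h1 h2
      refine Runs.mono (runs_scan_last (k := Reg.inp) (S := regs (.semi :: i) o [] [] c d [] r)
        (f := fun x => if x = .semi then (push .out x).seq (push .inp x) else
          (push .inp x).seq treatmentBlock) (p := (· != .semi)) rfl rfl
        (by
          rw [if_pos rfl, update_regs_inp]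
          exact h1.seq h2)) (Nat.le_add_left _ _)
    | cons t ts ih =>
      intro hN o d r
      rw [List.flatMap_cons, List.length_append] at hN
      have h2 := runs_treatmentBlock t (ts.flatMap levels ++ .semi :: i) o c d [] r
      have h3 := runs_unread t (f := fun x => if x = .semi then (push .out x).seq (push .inp x) else
        (push .inp x).seq treatmentBlock) (fun x hx => if_neg hx) h2
        (ih (by omega) ((levels t).reverse ++ o) ((levels t).reverse ++ d) (.tick :: r))
      simp only [List.flatMap_cons, List.reverse_append, List.append_assoc, List.length_cons,
        List.replicate_succ', List.singleton_append]
      refine h3.mono ?_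
      have : 11 * (levels t).length ≤ 11 * N := by omega
      rw [Nat.succ_mul ts.length]
      omega
  have h2 := runs_each_push (S := regs (.semi :: i) (.semi :: ((ts.flatMap levels).reverse ++ o))
    [] [] c (ts.flatMap levels).reverse [] (List.replicate ts.length .tick))
    (k := .d) (k' := .inp) (by decide) rfl
  have h1 := h1 ts hN o [] []
  simp only [update_regs_d, update_regs_inp, regs_d, regs_inp, List.append_nil,
    List.reverse_reverse, List.length_reverse] at h1 h2
  exact (h1.seq h2).mono (by omega)

/-- Output the records of `m` dummies of a treatment sample. -/
def dummyBlock (m : ℕ) : Prog Reg InSymbol :=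
  ((readTo .a).seq (readTo .a)).seq ((scan .r (fun _ => skip) fun _ => false).seq
    ((rep (echo.seq putDistances) m).seq ((each .a fun _ => skip).seq (push .l .tick))))

/-- A tick leaves `r` before the records are written and enters `l` afterwards. So while they are
written, `l` counts the predecessors and `r` the successors of the current sample, which has a tick
on neither. -/
theorem runs_dummyBlock (m : ℕ) (t : ℕ × ℕ) (i o c l r : List InSymbol) :
    Runs (dummyBlock m) (regs (levels t ++ i) o [] [] c [] l (.tick :: r))
      (regs i ((List.replicate m
        (levels t ++ dummyDistances c.length l.length r.length)).flatten.reverse ++ o) [] [] c []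
        (.tick :: l) r)
      (3 * (levels t).length + 3 +
        m * (5 * (levels t).length + 8 + (l.length + r.length) * (5 * c.length + 7))) := by
  have h1 := runs_readTo_readTo t i o c [] l (.tick :: r)
  generalize levels t = W at *
  have h2 := runs_scan_last (k := Reg.r) (S := regs i o W.reverse [] c [] l (.tick :: r))
    (f := fun _ => skip) (p := fun _ => false) rfl rfl (Runs.skip _)
  have h3 := runs_rep (q := echo.seq putDistances) (fun n => regs i ((List.replicate n
    (W ++ dummyDistances c.length l.length r.length)).flatten.reverse ++ o) W.reverse [] c [] l r)
    (5 * W.length + 8 + (l.length + r.length) * (5 * c.length + 7)) (fun n => by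
      set o' := (List.replicate n
        (W ++ dummyDistances c.length l.length r.length)).flatten.reverse ++ o
      have h4 := runs_echo i o' W.reverse c [] l r
      have h5 := runs_putDistances i (W.reverse ++ o') W.reverse c l r
      rw [reverse_flatten_replicate_succ, List.reverse_append, List.append_assoc]
      exact (h4.seq h5).mono (by rw [List.length_reverse]; omega)) m
  set o' := (List.replicate m
    (W ++ dummyDistances c.length l.length r.length)).flatten.reverse ++ o
  have h4 := runs_each_skip (S := regs i o' W.reverse [] c [] l r) (k := .a) rfl
  have h5 := Runs.push Reg.l InSymbol.tick (regs i o' [] [] c [] l r)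
  simp only [update_regs_a, update_regs_l, update_regs_r, regs_a, regs_l, List.length_reverse,
    List.replicate_zero, List.flatten_nil, List.reverse_nil, List.nil_append] at h2 h3 h4 h5
  exact (h1.seq (h2.seq (h3.seq (h4.seq h5)))).mono (by omega)

/-- The records of the dummies, for a list of treatment samples with `p` predecessors. -/
def dummyRecords (N m : ℕ) : ℕ → List (ℕ × ℕ) → List InSymbol
  | _, [] => []
  | p, t :: ts => (List.replicate m (levels t ++ dummyDistances N p ts.length)).flatten ++
      dummyRecords N m (p + 1) ts

/-- Output the records of the dummies of all treatment samples. -/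
def putDummies (m : ℕ) : Prog Reg InSymbol :=
  (scan .inp (fun x => if x = .semi then skip else (push .inp x).seq (dummyBlock m))
    (· != .semi)).seq (each .l fun _ => skip)

theorem runs_putDummies (m : ℕ) (ts : List (ℕ × ℕ)) (i o c : List InSymbol)
    (hc : (ts.flatMap levels).length ≤ c.length) (hc' : ts.length ≤ c.length) :
    Runs (putDummies m) (regs (ts.flatMap levels ++ .semi :: i) o [] [] c [] []
        (List.replicate ts.length .tick))
      (regs i ((dummyRecords c.length m 0 ts).reverse ++ o) [] [] c [] [] [])
      (c.length * (3 * c.length + 5 + m * (5 * c.length + 8 + c.length * (5 * c.length + 7)))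
        + c.length + 2) := by
  -- Here `p` is the number of samples already processed; bounding all lengths by `c.length` gives
  -- every pass the same time bound.
  have h1 : ∀ ts : List (ℕ × ℕ), (ts.flatMap levels).length ≤ c.length → ∀ o p,
      p + ts.length ≤ c.length →
      Runs (scan .inp (fun x => if x = .semi then skip else (push .inp x).seq (dummyBlock m))
        (· != .semi))
      (regs (ts.flatMap levels ++ .semi :: i) o [] [] c [] (List.replicate p .tick)
        (List.replicate ts.length .tick))
      (regs i ((dummyRecords c.length m p ts).reverse ++ o) [] [] c []
        (List.replicate (p + ts.length) .tick) [])
      (ts.length * (3 * c.length + 5 + m * (5 * c.length + 8 + c.length * (5 * c.length + 7)))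
        + 1) := by
    intro ts
    induction ts with
    | nil =>
      intro _ o p _
      refine Runs.mono (runs_scan_last (k := Reg.inp)
        (S := regs (.semi :: i) o [] [] c [] (List.replicate p .tick) [])
        (f := fun x => if x = .semi then skip else (push .inp x).seq (dummyBlock m))
        (p := (· != .semi)) rfl rfl
        (by
          rw [if_pos rfl, update_regs_inp]
          exact Runs.skip _)) (Nat.le_add_left _ _)
    | cons t ts ih =>
      intro hN o p hp
      rw [List.flatMap_cons, List.length_append] at hN
      rw [List.length_cons] at hp
      have h2 := runs_dummyBlock m t (ts.flatMap levels ++ .semi :: i) o c (List.replicate p .tick)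
        (List.replicate ts.length .tick)
      simp only [List.length_replicate] at h2
      have h3 := runs_unread t (f := fun x => if x = .semi then skip else
        (push .inp x).seq (dummyBlock m)) (fun x hx => if_neg hx) h2
        (by simpa only [List.replicate_succ] using ih (by omega) ((List.replicate m (levels t ++
          dummyDistances c.length p ts.length)).flatten.reverse ++ o) (p + 1) (by omega))
      simp only [List.flatMap_cons, dummyRecords, List.reverse_append, List.append_assoc,
        List.length_cons, List.replicate_succ]
      rw [show p + (ts.length + 1) = p + 1 + ts.length by omega]
      refine h3.mono ?_
      have ha : m * (5 * (levels t).length + 8 + (p + ts.length) * (5 * c.length + 7)) ≤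
          m * (5 * c.length + 8 + c.length * (5 * c.length + 7)) := by
        gcongr
        · omega
        · omega
      rw [Nat.succ_mul ts.length]
      omega
  have h2 := runs_each_skip (S := regs i ((dummyRecords c.length m 0 ts).reverse ++ o) [] [] c []
    (List.replicate (0 + ts.length) .tick) []) (k := .l) rfl
  have h1 := h1 ts hc o 0 (by omega)
  simp only [update_regs_l, regs_l, List.length_replicate] at h2
  refine (h1.seq h2).mono ?_
  have := Nat.mul_le_mul_right
    (3 * c.length + 5 + m * (5 * c.length + 8 + c.length * (5 * c.length + 7))) hc'
  omega

/-- Output the distances in the record of a control sample, increased by the number that is stored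
on the stack `c`. -/
def raiseDistances : Prog Reg InSymbol :=
  scan .inp (fun x => if x = .semi then push .out x else
    (push .inp x).seq (ticks.seq (readTo .out))) (· != .semi)

/-- Output the records of the control samples, with increased distances. -/
def raiseControls : Prog Reg InSymbol :=
  each .inp fun x => (push .inp x).seq
    ((readTo .out).seq ((readTo .out).seq raiseDistances))

/-- In unary, adding the stored number means emitting its ticks before copying the numeral with its
comma. -/
theorem transduces_raiseDistances (c : List InSymbol) (d : ℕ) :
    Transduces raiseDistances (fun i o => regs i o [] [] c [] [] []) (5 * c.length + 6) (unary d)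
      (unary (c.length + d)) := by
  obtain ⟨x, hx, hx'⟩ := head?_unary_append d []
  rw [List.append_nil] at hx
  refine Transduces.of_unread (fun _ _ => rfl) hx hx' (if_neg (by simpa using hx'))
    fun r o => ⟨5 * c.length + 2 + 2 * (unary d).length, ?_, ?_⟩
  · have : 0 < (unary d).length := by simp [length_unary]
    nlinarith
  · have h1 := runs_ticks (unary d ++ r) o [] c [] [] []
    have h2 := runs_readTo (k := .out) (by decide)
      (S := regs (unary d ++ r) (List.replicate c.length .tick ++ o) [] [] c [] [] [])
      (m := d) (r := r) rfl
    simp only [update_regs_inp, update_regs_out, regs_out] at h2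
    have h : (unary (c.length + d)).reverse ++ o =
        (unary d).reverse ++ (List.replicate c.length .tick ++ o) := by
      rw [Nat.add_comm, unary, List.replicate_add]
      simp [unary, ← List.append_assoc, List.replicate_append_replicate]
    rw [h]
    exact h1.seq h2

theorem transduces_raiseControls (c : List InSymbol) (t : ℕ × ℕ) (ds : List ℕ) :
    Transduces raiseControls (fun i o => regs i o [] [] c [] [] []) (5 * c.length + 10)
      (levels t ++ ds.flatMap unary ++ [.semi])
      (levels t ++ ds.flatMap (fun d => unary (c.length + d)) ++ [.semi]) := by
  obtain ⟨x, w, hw, -⟩ := exists_levels_append t (ds.flatMap unary ++ [.semi])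
  have hx : (levels t ++ ds.flatMap unary ++ [InSymbol.semi]).head? = some x := by
    rw [List.append_assoc, hw, List.head?_cons]
  refine Transduces.of_unread (fun _ _ => rfl) hx rfl rfl fun r o => ?_
  have h1 := runs_readTo (k := .out) (by decide)
    (S := regs (unary t.1 ++ (unary t.2 ++ (ds.flatMap unary ++ .semi :: r))) o [] [] c [] [] [])
    (m := t.1) rfl
  have h2 := runs_readTo (k := .out) (by decide)
    (S := regs (unary t.2 ++ (ds.flatMap unary ++ .semi :: r)) ((unary t.1).reverse ++ o)
      [] [] c [] [] []) (m := t.2) rfl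
  have h3 := Transduces.flatMap ds (fun d _ => transduces_raiseDistances c d) (.semi :: r)
    ((unary t.2).reverse ++ ((unary t.1).reverse ++ o)) _ _
    (runs_scan_last rfl rfl (Runs.push _ _ _))
  simp only [update_regs_inp, update_regs_out, regs_out] at h1 h2 h3
  refine ⟨2 * (unary t.1).length + (2 * (unary t.2).length +
    (1 + 1 + (5 * c.length + 6) * (ds.flatMap unary).length)), ?_,
      by simpa [levels] using h1.seq (h2.seq h3)⟩
  simp only [levels, List.length_append, List.length_singleton]
  nlinarith

/-- Save the length of the input on the stack `c`. -/
def saveLength : Prog Reg InSymbol :=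
  (each .inp fun x => (push .a x).seq (push .c x)).seq (each .a (push .inp))

theorem runs_saveLength (w : List InSymbol) :
    Runs saveLength (ioRegs w []) (regs w [] [] [] w.reverse [] [] []) (5 * w.length + 2) := by
  have h1 := runs_each_push_push (S := ioRegs w []) (k := .inp) (k' := .a) (k'' := .c)
    (by decide) (by decide) (by decide) rfl
  have h2 := runs_each_push (S := regs [] [] w.reverse [] w.reverse [] [] []) (k := .a)
    (k' := .inp) (by decide) rfl
  simp only [update_regs_inp, update_regs_a, update_regs_c, regs_inp, regs_a, regs_c,
    List.append_nil, List.reverse_reverse, List.length_reverse] at h1 h2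
  exact (h1.seq h2).mono (by omega)

/-- Reduction of BM to `(m + 1)`-BM. -/
def padProg (m : ℕ) : Prog Reg InSymbol :=
  (saveLength.seq ((readTo .out).seq (copyTreatmentsOnce.seq ((putDummies m).seq
    (raiseControls.seq (each .c fun _ => skip)))))).seq (each .out (push .inp))

theorem runs_padProg (m k : ℕ) (ts : List (ℕ × ℕ)) (cs : List ((ℕ × ℕ) × List ℕ))
    {w : List InSymbol} (hw : w = unary k ++ ts.flatMap levels ++ [.semi] ++
      cs.flatMap fun c => levels c.1 ++ c.2.flatMap unary ++ [.semi]) :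
    Runs (padProg m) (ioRegs w [])
      (ioRegs (unary k ++ ts.flatMap levels ++ [.semi] ++ (dummyRecords w.length m 0 ts ++
        cs.flatMap fun c => levels c.1 ++ c.2.flatMap (fun d => unary (w.length + d)) ++ [.semi]))
        [])
      (3 * (w.length * (3 * w.length + 5 +
        m * (5 * w.length + 8 + w.length * (5 * w.length + 7))) +
        (5 * w.length + 10) * w.length + w.length * (11 * w.length + 7) + 11 * w.length + 10)
        + 1) := by
  have ht : ∀ ts : List (ℕ × ℕ), ts.length ≤ (ts.flatMap levels).length := by
    intro ts
    induction ts with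
    | nil => exact le_rfl
    | cons t ts ih =>
      have := le_length_levels t
      simp only [List.flatMap_cons, List.length_append, List.length_cons]
      omega
  have ht := ht ts
  have h0 := runs_saveLength w
  have h5 := Transduces.flatMap cs (fun c _ => transduces_raiseControls w.reverse c.1 c.2)
  have hlen := congrArg List.length hw
  simp only [List.length_append, List.length_singleton] at hlen
  have h2 := fun i o => runs_copyTreatmentsOnce w.length ts (by omega) i o w.reverse
  have h3 := fun i o => runs_putDummies m ts i o w.reverse
    (by rw [List.length_reverse]; omega) (by rw [List.length_reverse]; omega)
  simp only [List.length_reverse] at h3 h5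
  generalize (cs.flatMap fun c => levels c.1 ++ c.2.flatMap (fun d => unary (w.length + d)) ++
    [.semi]) = C' at *
  generalize (cs.flatMap fun c => levels c.1 ++ c.2.flatMap unary ++ [.semi]) = C at *
  generalize dummyRecords w.length m 0 ts = D at *
  generalize ts.flatMap levels = T at *
  have h1 := runs_readTo (k := .out) (by decide)
    (S := regs w [] [] [] w.reverse [] [] []) (m := k) (r := T ++ .semi :: C) (by simp [hw])
  have h2 := h2 C (unary k).reverse
  have h3 := h3 C (.semi :: (T.reverse ++ (unary k).reverse))
  have h5 := h5 [] (D.reverse ++ (.semi :: (T.reverse ++ (unary k).reverse))) _ _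
    (runs_scan_nil rfl)
  have h6 := runs_each_skip (S := regs [] (C'.reverse ++ (D.reverse ++
    (.semi :: (T.reverse ++ (unary k).reverse)))) [] [] w.reverse [] [] []) (k := .c) rfl
  simp only [update_regs_inp, update_regs_out, update_regs_c, regs_out, regs_c, List.append_nil,
    List.length_reverse] at h1 h5 h6
  have h := h0.seq (h1.seq (h2.seq (h3.seq (h5.seq h6))))
  -- The output is no longer than the time spent so far, so turning it over at most triples the
  -- bound, up to the final `+ 1`.
  have hl := h.length_le .out
  have h7 := runs_each_push (S := ioRegs [] (C'.reverse ++ (D.reverse ++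
    (.semi :: (T.reverse ++ (unary k).reverse))))) (k := .out) (k' := .inp) (by decide) rfl
  simp only [update_regs_inp, update_regs_out, regs_out, regs_inp, List.append_nil,
    List.length_nil, List.reverse_append, List.reverse_cons, List.reverse_reverse] at h7 hl
  have h8 := h.seq h7
  simp only [List.append_assoc, List.singleton_append] at h8 ⊢
  refine h8.mono ?_
  have ha : ts.length * (11 * w.length + 7) ≤ w.length * (11 * w.length + 7) := by
    gcongr
    omega
  have hb : (5 * w.length + 10) * C.length ≤ (5 * w.length + 10) * w.length := by
    gcongr
    omega
  omega

end Pad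

end FineBalance

/-! ### The padding program writes the encoding of the padded instance; conclusion. -/

namespace FineBalance

open StackProgram StackProgram.Prog Turing

theorem dummyDistances_eq (N n : ℕ) (i : Fin n) :
    dummyDistances N i (n - 1 - i) =
      ((List.finRange n).flatMap fun i' => unary (if i = i' then 0 else N)) ++ [.semi] := by
  obtain ⟨p, hp⟩ := i
  -- Splitting the indices into predecessors, the owner and successors makes the conditional
  -- constant on each of the three ranges.
  obtain ⟨q, rfl⟩ : ∃ q, n = p + (1 + q) := ⟨n - p - 1, by omega⟩
  have h1 : ∀ x : Fin p, (⟨p, hp⟩ : Fin (p + (1 + q))) ≠ Fin.castAdd (1 + q) x := fun x h => by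
    have := congrArg Fin.val h
    simp only [Fin.val_castAdd] at this
    omega
  have h2 : ∀ x : Fin 1, (⟨p, hp⟩ : Fin (p + (1 + q))) = Fin.natAdd p (Fin.castAdd q x) :=
    fun x => by ext; simp
  have h3 : ∀ x : Fin q, (⟨p, hp⟩ : Fin (p + (1 + q))) ≠ Fin.natAdd p (Fin.natAdd 1 x) :=
    fun x h => by
      have := congrArg Fin.val h
      simp only [Fin.val_natAdd] at this
      omega
  rw [List.finRange_add_flatMap, List.finRange_add_flatMap]
  simp only [if_neg (h1 _), if_pos (h2 _), if_neg (h3 _), List.finRange_flatMap_const,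
    dummyDistances]
  rw [show p + (1 + q) - 1 - p = q by omega]
  simp

theorem dummyRecords_map (N m p : ℕ) {n : ℕ} (lev : Fin n → ℕ × ℕ) :
    dummyRecords N m p ((List.finRange n).map lev) = (List.finRange n).flatMap fun i =>
      (List.replicate m (levels (lev i) ++ dummyDistances N (p + i) (n - 1 - i))).flatten := by
  induction n generalizing p with
  | zero => rfl
  | succ n ih =>
    have h := ih (p + 1) fun i => lev i.succ
    rw [List.finRange_succ, List.map_cons, List.map_map, dummyRecords, List.flatMap_cons,
      List.flatMap_map, List.length_map, List.length_finRange]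
    change _ ++ dummyRecords N m (p + 1) ((List.finRange n).map fun i => lev i.succ) = _
    rw [h]
    congr 1
    refine List.flatMap_congr fun i _ => ?_
    rw [Fin.val_succ, show p + 1 + (i : ℕ) = p + (i + 1) by omega,
      show n + 1 - 1 - ((i : ℕ) + 1) = n - 1 - i by omega]

namespace Instance

theorem encode_padded_eq {k₂ : ℕ} (m : ℕ) (I : Instance k₂) : (I.padded m).encode = unary I.k₁ ++
    ((List.finRange I.n).map fun i => ((I.tLevel₁ i : ℕ), (I.tLevel₂ i : ℕ))).flatMap levels ++
      [.semi] ++ (dummyRecords I.encode.length m 0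
        ((List.finRange I.n).map fun i => ((I.tLevel₁ i : ℕ), (I.tLevel₂ i : ℕ))) ++
    ((List.finRange I.n').map fun j => (((I.cLevel₁ j : ℕ), (I.cLevel₂ j : ℕ)),
      (List.finRange I.n).map fun i => I.dist i j)).flatMap
        fun c => levels c.1 ++ c.2.flatMap (fun d => unary (I.encode.length + d)) ++ [.semi]) := by
  rw [dummyRecords_map, encode]
  simp only [List.finRange_add_flatMap, List.finRange_mul_flatMap, Fin.addCases_left,
    Fin.addCases_right, divNat_finProdFinEquiv, List.finRange_flatMap_const, List.flatMap_map,
    Nat.zero_add, dummyDistances_eq, levels, List.append_assoc]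

theorem polyComputes_padded (m k₂ : ℕ) :
    PolyComputes (encode (k₂ := k₂)) fun I => (I.padded m).encode := by
  refine PolyComputes.of_runs (padProg m) .inp
    (3 * (.X * (3 * .X + 5 + .C m * (5 * .X + 8 + .X * (5 * .X + 7))) + (5 * .X + 10) * .X +
      .X * (11 * .X + 7) + 11 * .X + 10) + 1) fun I => ?_
  rw [update_nil_inp, update_nil_inp, encode_padded_eq]
  refine (runs_padProg m I.k₁ _ _ (encode_eq I)).mono (le_of_eq ?_)
  simp

end Instance

theorem HasPolyTimeAlgorithm.one_of_succ {m k₂ : ℕ} (hm : m ≠ 0)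
    (h : HasPolyTimeAlgorithm (m + 1) k₂) : HasPolyTimeAlgorithm 1 k₂ := by
  refine h.of_reduction (fun I => I.padded m) (Instance.polyComputes_padded m k₂) (checkProg m)
    (Polynomial.C (m + 30) * Polynomial.X + Polynomial.C 30) fun I w hw => ?_
  obtain ⟨w', hw', hr⟩ := Instance.exists_answer_of_padded hm hw
  refine ⟨w', hw', ?_⟩
  simpa only [Polynomial.eval_add, Polynomial.eval_mul, Polynomial.eval_X, Polynomial.eval_C]
    using hr

end FineBalance

/-- For all constants `κ ≥ 2` and `k₂`, there is a polynomial time algorithm for BM' with `k₂`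
levels of the second covariate if and only if there is one for `κ`-BM' with `k₂` levels of the
second covariate. -/
theorem mainTheorem9 (κ : ℕ) (hκ : 2 ≤ κ) (k₂ : ℕ) :
    FineBalance.BMHasPolyTimeAlgorithm k₂ ↔ FineBalance.HasPolyTimeAlgorithm κ k₂ := by
  -- The number of dummies per treatment sample is `m = κ - 1`. It is positive because `κ ≥ 2`, as
  -- the test of dummy rows requires.
  obtain ⟨m, rfl⟩ : ∃ m, κ = m + 1 := ⟨κ - 1, by omega⟩
  exact ⟨fun h => .of_one (by omega) h, fun h => .one_of_succ (by omega) h⟩
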